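/- For a finite-dimensional Hilbert space $\mathcal H$ and an operator $A$ on $\mathcal H\otimes\mathcal H$ put $$N=\dim\mathcal H,\qquad X=\frac{\dim \mathrm{Im}(A)}{\dim \mathrm{Sym}^2(\mathcal H)},\qquad P_{\mathrm{cr}}=\frac{1-X}{1+X},$$ where $\mathrm{Sym}^2(\mathcal H)\subset\mathcal H\otimes\mathcal H$ is the space of vectors fixed by the exchange of the two copies. Let $d,L\ge 1$ be integers. On $(\mathbb C^d)^{\otimes L}\otimes(\mathbb C^d)^{\otimes L}$, with tensor factors labelled $1,\dots,L$ (first copy) and $1',\dots,L'$ (second copy), let $\mathbb P^+_{ii'}$ be the orthogonal projection onto the vectors symmetric under the interchange of factors $i$ and $i'$, and let $\mathbb P^{\mathrm{sym}}_{\{1,\dots,L\}}$, $\mathbb P^{\mathrm{asym}}_{\{1,\dots,L\}}$ (and the same with primes) be the orthogonal projections onto the vectors that are completely symmetric, respectively completely antisymmetric, in the indicated factors. In each case below $\mathbb P^{\mathrm{sym}}$ denotes the orthogonal projection onto $\mathrm{Sym}^2(\mathcal H)$, unless stated otherwise, and the displayed expression for $A$ is understood as an operator on $\mathcal H\otimes\mathcal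 H$, i.e. compressed to $\mathcal H\otimes\mathcal H$ by the orthogonal projection onto it. Then the following hold. 1. (Separable states) For $\mathcal H=(\mathbb C^d)^{\otimes L}$ and $A=\mathbb P^{\mathrm{sym}}-\mathbb P^+_{11'}\cdots\mathbb P^+_{LL'}$: $$N=d^L,\qquad 1-X=2^{1-L}\,\frac{(d+1)^L}{d^L+1}.$$ 2. (Separable bosonic states) For $\mathcal H=\mathrm{Sym}^L(\mathbb C^d)$ and $A=\mathbb P^{\mathrm{sym}}-\big(\mathbb P^+_{11'}\cdots\mathbb P^+_{LL'}\big)\big(\mathbb P^{\mathrm{sym}}_{\{1,\dots,L\}}\mathbb P^{\mathrm{sym}}_{\{1',\dots,L'\}}\big)$: $$N=\binom{d+L-1}{L},\qquad 1-X=\frac{2\binom{d+2L-1}{2L}}{\binom{d+L-1}{L}\left(\binom{d+L-1}{L}+1\right)}.$$ 3. (Slater determinants) For $L\le d$, $\mathcal H=\bigwedge^L(\mathbb C^d)$ and $A=\mathbb P^{\mathrm{sym}}-\frac{2^L}{L+1}\big(\mathbb P^+_{11'}\cdots\mathbb P^+_{LL'}\big)\big(\mathbb P^{\mathrm{asym}}_{\{1,\dots,L\}}\mathbb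 P^{\mathrm{asym}}_{\{1',\dots,L'\}}\big)$: $$N=\binom dL,\qquad 1-X=\frac{2\binom dL}{\binom dL+1}\cdot\frac{d+1}{(L+1)(d+1-L)}.$$ 4. (Fermionic Gaussian states) Let $a_1,\dots,a_d$ be the standard annihilation operators on the Fock space $\mathcal F=\bigoplus_{k=0}^d\bigwedge^k(\mathbb C^d)$, let $c_{2k-1}=a_k+a_k^\dagger$, $c_{2k}=i(a_k-a_k^\dagger)$, and let $\mathbb P_0$ be the orthogonal projection onto the kernel of $\Lambda=\sum_{i=1}^{2d}c_i\otimes c_i$ on $\mathcal F\otimes\mathcal F$. Let $\mathcal H\subset\mathcal F$ be the even, or the odd, sector, i.e. the span of the vectors of even, respectively odd, particle number, and let $A=\mathbb P^{\mathrm{sym}}_g-\mathbb P_0$, where $\mathbb P^{\mathrm{sym}}_g$ is the orthogonal projection onto $\mathrm{Sym}^2(\mathcal F)$. Then for either sector $$N=2^{d-1},\qquad 1-X=\frac{\binom{2d}{d}}{(2^{d-1}+1)\,2^{d-1}}.$$ In each case, writing $y$ for the stated value of $1-X$, one has $P_{\mathrm{cr}}=\dfrac{y}{2-y}$. -/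

import Mathlib

noncomputable section

namespace QCorr

/-! ## Two copies of a finite-dimensional Hilbert space

A Hilbert space with a distinguished orthonormal basis indexed by `ι` is `EuclideanSpace ℂ ι`; its
tensor square is `EuclideanSpace ℂ (ι × ι)`, the product basis vectors being indexed by pairs. -/

/-- The tensor product `u ⊗ v`. -/
def tens {ι : Type*} (u v : EuclideanSpace ℂ ι) : EuclideanSpace ℂ (ι × ι) :=
  WithLp.toLp 2 fun p => u p.1 * v p.2

/-- The vectors whose coordinates satisfy `w (f p) = ε * w p` for all `p`. -/
def invariantUnder {κ : Type*} (f : κ → κ) (ε : ℂ) : Submodule ℂ (EuclideanSpace ℂ κ) where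
  carrier := {w | ∀ p, w (f p) = ε * w p}
  add_mem' := by
    intro a b ha hb p
    simp only [Set.mem_ofPred_eq] at ha hb
    simp [ha p, hb p, mul_add]
  zero_mem' := by
    intro p
    simp
  smul_mem' := by
    intro c a ha p
    simp only [Set.mem_ofPred_eq] at ha
    simp [ha p, mul_left_comm]

/-- `H ⊗ H`, inside the tensor square of the ambient space, for a subspace `H`. -/
def tensorSq {ι : Type*} (H : Submodule ℂ (EuclideanSpace ℂ ι)) :
    Submodule ℂ (EuclideanSpace ℂ (ι × ι)) :=
  Submodule.span ℂ {w | ∃ u ∈ H, ∃ v ∈ H, w = tens u v}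

/-- `Sym² H`: the vectors of `H ⊗ H` that are fixed by the exchange of the two copies. -/
def symSq {ι : Type*} (H : Submodule ℂ (EuclideanSpace ℂ ι)) :
    Submodule ℂ (EuclideanSpace ℂ (ι × ι)) :=
  tensorSq H ⊓ invariantUnder Prod.swap 1

variable {ι : Type*} [Fintype ι]

/-- The operator on `H ⊗ H` given by an operator `T` on the tensor square of the ambient space: the
compression of `T` to `H ⊗ H`, extended by zero to the orthogonal complement of `H ⊗ H`. -/
def compress (H : Submodule ℂ (EuclideanSpace ℂ ι))
    (T : EuclideanSpace ℂ (ι × ι) →L[ℂ] EuclideanSpace ℂ (ι × ι)) :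
    EuclideanSpace ℂ (ι × ι) →L[ℂ] EuclideanSpace ℂ (ι × ι) :=
  (tensorSq H).starProjection * T * (tensorSq H).starProjection

/-- `X = dim (Im A) / dim (Sym² H)`. -/
def X (H : Submodule ℂ (EuclideanSpace ℂ ι))
    (A : EuclideanSpace ℂ (ι × ι) →L[ℂ] EuclideanSpace ℂ (ι × ι)) : ℝ :=
  (Module.finrank ℂ (LinearMap.range A.toLinearMap) : ℝ) / (Module.finrank ℂ (symSq H) : ℝ)

/-- The critical purity `P_cr = (1 - X) / (1 + X)`. -/
def Pcr (H : Submodule ℂ (EuclideanSpace ℂ ι))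
    (A : EuclideanSpace ℂ (ι × ι) →L[ℂ] EuclideanSpace ℂ (ι × ι)) : ℝ :=
  (1 - X H A) / (1 + X H A)

/-- For the Hilbert space `H` and the operator `A` on `H ⊗ H`: `N = dim H` equals `N`, `1 - X`
equals `y`, and `P_cr` is the value determined by `y`. -/
def TableRow (H : Submodule ℂ (EuclideanSpace ℂ ι))
    (A : EuclideanSpace ℂ (ι × ι) →L[ℂ] EuclideanSpace ℂ (ι × ι)) (N : ℕ) (y : ℝ) : Prop :=
  Module.finrank ℂ H = N ∧ 1 - X H A = y ∧ Pcr H A = y / (2 - y)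

/-! ## `L` particles with single-particle space `ℂ^d`

The space `(ℂ^d)^{⊗L}` is `EuclideanSpace ℂ (Fin L → Fin d)`: the multi-index `x` labels the basis
vector `e_{x 0} ⊗ ⋯ ⊗ e_{x (L-1)}`. -/

/-- The multi-indices of `(ℂ^d)^{⊗L}`. -/
abbrev Idx (d L : ℕ) : Type := Fin L → Fin d

/-- Operators on `(ℂ^d)^{⊗L} ⊗ (ℂ^d)^{⊗L}`. -/
abbrev Op₂ (d L : ℕ) : Type :=
  EuclideanSpace ℂ (Idx d L × Idx d L) →L[ℂ] EuclideanSpace ℂ (Idx d L × Idx d L)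

/-- `Sym^L (ℂ^d)`. -/
def bosonSpace (d L : ℕ) : Submodule ℂ (EuclideanSpace ℂ (Idx d L)) :=
  ⨅ σ : Equiv.Perm (Fin L), invariantUnder (fun x => x ∘ σ) 1

/-- `⋀^L (ℂ^d)`. -/
def fermionSpace (d L : ℕ) : Submodule ℂ (EuclideanSpace ℂ (Idx d L)) :=
  ⨅ σ : Equiv.Perm (Fin L), invariantUnder (fun x => x ∘ σ) ((Equiv.Perm.sign σ : ℤ) : ℂ)

/-- The projector `P⁺_{ii'}` on the vectors that are symmetric under the interchange of the `i`-th
factor of the first copy and the `i`-th factor of the second copy. -/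
def pairProj (d L : ℕ) (i : Fin L) : Op₂ d L :=
  (invariantUnder (fun p : Idx d L × Idx d L =>
    (Function.update p.1 i (p.2 i), Function.update p.2 i (p.1 i))) 1).starProjection

/-- The product `P⁺_{11'} P⁺_{22'} ⋯ P⁺_{LL'}`. -/
def pairProjProd (d L : ℕ) : Op₂ d L :=
  (List.ofFn (pairProj d L)).prod

/-- The projector on the vectors that are symmetric in the factors `1, …, L` (first copy). -/
def symProj₁ (d L : ℕ) : Op₂ d L :=
  (⨅ σ : Equiv.Perm (Fin L), invariantUnder
    (fun p : Idx d L × Idx d L => (p.1 ∘ σ, p.2)) 1).starProjection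

/-- The projector on the vectors that are symmetric in the factors `1', …, L'` (second copy). -/
def symProj₂ (d L : ℕ) : Op₂ d L :=
  (⨅ σ : Equiv.Perm (Fin L), invariantUnder
    (fun p : Idx d L × Idx d L => (p.1, p.2 ∘ σ)) 1).starProjection

/-- The projector on the vectors that are antisymmetric in the factors `1, …, L` (first copy). -/
def asymProj₁ (d L : ℕ) : Op₂ d L :=
  (⨅ σ : Equiv.Perm (Fin L), invariantUnder
    (fun p : Idx d L × Idx d L => (p.1 ∘ σ, p.2))
      ((Equiv.Perm.sign σ : ℤ) : ℂ)).starProjection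

/-- The projector on the vectors that are antisymmetric in the factors `1', …, L'` (second copy). -/
def asymProj₂ (d L : ℕ) : Op₂ d L :=
  (⨅ σ : Equiv.Perm (Fin L), invariantUnder
    (fun p : Idx d L × Idx d L => (p.1, p.2 ∘ σ))
      ((Equiv.Perm.sign σ : ℤ) : ℂ)).starProjection

/-- Separable states: `P^sym - P⁺_{11'} ⋯ P⁺_{LL'}`, on the whole of `(ℂ^d)^{⊗L}`. -/
def sepA (d L : ℕ) : Op₂ d L :=
  (symSq (⊤ : Submodule ℂ (EuclideanSpace ℂ (Idx d L)))).starProjection - pairProjProd d L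

/-- Separable bosonic states:
`P_b^sym - (P⁺_{11'} ⋯ P⁺_{LL'}) (P^sym_{1,…,L} P^sym_{1',…,L'})`, as an operator on
`Sym^L (ℂ^d) ⊗ Sym^L (ℂ^d)`. -/
def bosonA (d L : ℕ) : Op₂ d L :=
  compress (bosonSpace d L)
    ((symSq (bosonSpace d L)).starProjection -
      pairProjProd d L * (symProj₁ d L * symProj₂ d L))

/-- Slater determinants:
`P_f^sym - 2^L / (L + 1) (P⁺_{11'} ⋯ P⁺_{LL'}) (P^asym_{1,…,L} P^asym_{1',…,L'})`, as an operator on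
`⋀^L (ℂ^d) ⊗ ⋀^L (ℂ^d)`. -/
def slaterA (d L : ℕ) : Op₂ d L :=
  compress (fermionSpace d L)
    ((symSq (fermionSpace d L)).starProjection -
      ((2 : ℂ) ^ L / ((L : ℂ) + 1)) • (pairProjProd d L * (asymProj₁ d L * asymProj₂ d L)))

/-! ## The fermionic Fock space

The Fock space `⨁_L ⋀^L (ℂ^d)` is `EuclideanSpace ℂ (Finset (Fin d))`: the set `{i₁ < ⋯ < i_k}`
labels the basis vector `e_{i₁} ∧ ⋯ ∧ e_{i_k} = a†_{i₁} ⋯ a†_{i_k} |0⟩`. -/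

/-- The annihilation operator `a_i` in the occupation number basis:
`a_i |S ∪ {i}⟩ = (-1)^{#{j ∈ S, j < i}} |S⟩` for `i ∉ S`, and `a_i |S⟩ = 0` for `i ∉ S`. -/
def ann (d : ℕ) (i : Fin d) : Matrix (Finset (Fin d)) (Finset (Fin d)) ℂ :=
  Matrix.of fun S T =>
    if i ∉ S ∧ T = insert i S then (-1) ^ (S.filter fun j => j < i).card else 0

/-- The `2d` Majorana operators: `a_k + a_k†` (`c_{2k-1}`) for `(k, 0)` and `i (a_k - a_k†)`
(`c_{2k}`) for `(k, 1)`. -/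
def majorana (d : ℕ) (k : Fin d × Fin 2) : Matrix (Finset (Fin d)) (Finset (Fin d)) ℂ :=
  if k.2 = 0 then ann d k.1 + (ann d k.1).conjTranspose
  else Complex.I • (ann d k.1 - (ann d k.1).conjTranspose)

/-- `Λ = ∑ c_i ⊗ c_i`, the sum over all `2d` Majorana operators. -/
def majoranaLambda (d : ℕ) :
    Matrix (Finset (Fin d) × Finset (Fin d)) (Finset (Fin d) × Finset (Fin d)) ℂ :=
  ∑ k : Fin d × Fin 2, Matrix.kronecker (majorana d k) (majorana d k)

/-- The even (`r = 0`) or odd (`r = 1`) sector of the Fock space: the vectors supported on the basis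
states whose number of particles is congruent to `r` modulo `2`. -/
def fockSector (d : ℕ) (r : Fin 2) : Submodule ℂ (EuclideanSpace ℂ (Finset (Fin d))) where
  carrier := {u | ∀ S, S.card % 2 ≠ (r : ℕ) → u S = 0}
  add_mem' := by
    intro a b ha hb S hS
    simp [ha S hS, hb S hS]
  zero_mem' := by
    intro S _
    simp
  smul_mem' := by
    intro c a ha S hS
    simp [ha S hS]

/-- Fermionic Gaussian states: `P_g^sym - P_0`, with `P_g^sym` the projector on the symmetric square
of the Fock space and `P_0` the projector on the kernel of `Λ`, as an operator on the tensor square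
of the sector of parity `r`. -/
def gaussA (d : ℕ) (r : Fin 2) :
    EuclideanSpace ℂ (Finset (Fin d) × Finset (Fin d)) →L[ℂ]
      EuclideanSpace ℂ (Finset (Fin d) × Finset (Fin d)) :=
  compress (fockSector d r)
    ((symSq (⊤ : Submodule ℂ (EuclideanSpace ℂ (Finset (Fin d))))).starProjection -
      (LinearMap.ker (Matrix.toEuclideanLin (majoranaLambda d))).starProjection)

end QCorr

end

/-!
# Ranks of the operators `A = P_sym - T` and the critical purities they determine

In every row of the table `A` has the form `P_S - T`, where `S = Sym² H` and `T` is a symmetric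
operator with range in `S`. Such an operator vanishes on the orthogonal complement of `S`, and its
kernel inside `S` is the space `F` of fixed vectors of `T`, so that `rank A = dim S - dim F`
(`finrank_range_starProjection_sub`) and `1 - X = dim F / dim S`. Since `dim S = N (N + 1) / 2`
(`finrank_symSq`), each row amounts to computing `N` and `dim F` (`tableRow_of_fixed`).

* Separable states: `T` is the projection on the vectors that are symmetric under all interchanges
  of `i` and `i'`, that is, functions on `(Sym² (Fin d))^L`.
* Separable bosonic states: a fixed vector of the product of projections is fixed by each of them.
  The interchanges of `i` and `i'` and the two copies of `S_L` generate `S_{2L}`, so `F` is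
  `Sym^{2L} (ℂ^d)`, the functions on multisets of size `2L`.
* Slater determinants: with the `2L` factors arranged in `L` rows `{i, i'}` and two columns, `T` is a
  multiple of `c r c` for the column antisymmetrizer `c` and the row symmetrizer `r`. Von Neumann's
  argument (`exists_colAsym_mul_slotOp_mul_pairProjProd`) gives `c r c r = κ c r` with `κ`
  independent of `d`; for `d = L` the range of `c` is a line, so `κ` is the trace of `c r`, which is
  `(L + 1) / 2^L`. Hence `T` is idempotent and `dim F = tr T`. The traces reduce to counting pairs of
  injections `Fin L → Fin d` with the same image of a given set (`trace_colAsym_mul_slotOp`).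
* Fermionic Gaussian states: in the occupation number basis, `Λ` maps the component at `(S, T)` to
  the components at `(S ∆ {k}, T ∆ {k})` for `k ∈ S ∆ T`, with signs depending on `S ∆ T` only
  (`lambdaOp_apply`). Characters in `S`, for fixed `S ∆ T`, therefore diagonalize it: the eigenvectors
  are labelled by pairs `(A, B)` with `A ∆ B = S ∆ T`, and the eigenvalues are `2 (#A - #B)`. So
  `dim (ker Λ) = ∑ k, (d choose k)² = (2d choose d)`. The kernel is symmetric under the exchange of
  the copies, contains no components of mixed parity, and is divided equally between the two parity
  sectors by the simultaneous flip of one mode in both copies.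
-/

noncomputable section

namespace QCorr

open scoped InnerProductSpace Nat symmDiff

/-! ### Orthogonal projections and ranks -/

section Projections

variable {E : Type*} [NormedAddCommGroup E] [InnerProductSpace ℂ E] [FiniteDimensional ℂ E]

/-- A symmetric operator that maps into `K` and fixes `K` is the orthogonal projection on `K`. -/
theorem eq_starProjection_of_symmetric {K : Submodule ℂ E} {Q : E →L[ℂ] E}
    (hsymm : ∀ v w, ⟪Q v, w⟫_ℂ = ⟪v, Q w⟫_ℂ) (hmem : ∀ w, Q w ∈ K) (hfix : ∀ w ∈ K, Q w = w) :
    Q = K.starProjection := by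
  ext1 v
  refine (Submodule.eq_starProjection_of_mem_of_inner_eq_zero (hmem v) fun w hw => ?_).symm
  rw [inner_sub_left, hsymm, hfix w hw, sub_self]

/-- If `P_V` maps `B` into itself, then `P_V P_B P_V` is the projection on `B ⊓ V`. -/
theorem starProjection_mul_mul_of_mapsTo {B V : Submodule ℂ E}
    (h : ∀ w ∈ B, V.starProjection w ∈ B) :
    V.starProjection * B.starProjection * V.starProjection = (B ⊓ V).starProjection := by
  refine eq_starProjection_of_symmetric (fun v w => ?_) (fun w => ⟨?_, ?_⟩) fun w hw => ?_
  · simp only [mul_apply_eq_comp]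
    rw [Submodule.inner_starProjection_left_eq_right, Submodule.inner_starProjection_left_eq_right,
      Submodule.inner_starProjection_left_eq_right]
  · exact h _ (Submodule.starProjection_apply_mem _ _)
  · exact Submodule.starProjection_apply_mem _ _
  · simp only [mul_apply_eq_comp]
    rw [Submodule.starProjection_eq_self_iff.2 hw.2, Submodule.starProjection_eq_self_iff.2 hw.1,
      Submodule.starProjection_eq_self_iff.2 hw.2]

/-- Compressing a projection on a subspace of `V` to `V` changes nothing. -/
theorem starProjection_mul_mul_of_le {B V : Submodule ℂ E} (h : B ≤ V) :
    V.starProjection * B.starProjection * V.starProjection = B.starProjection := by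
  have hB : B ⊓ V = B := inf_eq_left.2 h
  conv_rhs => rw [← hB]
  exact starProjection_mul_mul_of_mapsTo fun w hw => by
    rwa [Submodule.starProjection_eq_self_iff.2 (h hw)]

/-- A projection on a space containing `V` acts as the identity after `P_V`. -/
theorem starProjection_mul_of_le {V K : Submodule ℂ E} (h : V ≤ K) :
    K.starProjection * V.starProjection = V.starProjection := by
  ext1 v
  exact Submodule.starProjection_eq_self_iff.2 (h (Submodule.starProjection_apply_mem _ _))

/-- The rank of `P_S - T`, for a symmetric `T` with range in `S`: the kernel of `P_S - T` in `S`
consists of the fixed vectors of `T`. -/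
theorem finrank_range_starProjection_sub {S F : Submodule ℂ E} {T : E →L[ℂ] E}
    (hsymm : ∀ v w, ⟪T v, w⟫_ℂ = ⟪v, T w⟫_ℂ) (hmem : ∀ w, T w ∈ S) (hF : ∀ w, w ∈ F ↔ T w = w) :
    Module.finrank ℂ (LinearMap.range (S.starProjection - T).toLinearMap) + Module.finrank ℂ F =
      Module.finrank ℂ S := by
  have hT0 : ∀ w ∈ Sᗮ, T w = 0 := fun w hw => by
    rw [← inner_self_eq_zero (𝕜 := ℂ), hsymm]
    exact Submodule.inner_left_of_mem_orthogonal (hmem _) hw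
  have hFS : F ≤ S := fun w hw => by
    rw [← (hF w).1 hw]; exact hmem w
  set A := (S.starProjection - T).toLinearMap with hA
  have hrange : LinearMap.range A = LinearMap.range (A.comp S.subtype) := by
    apply le_antisymm
    · rintro _ ⟨w, rfl⟩
      refine ⟨⟨S.starProjection w, Submodule.starProjection_apply_mem _ _⟩, ?_⟩
      have h1 := Submodule.sub_starProjection_mem_orthogonal (K := S) w
      have h2 : A (w - S.starProjection w) = 0 := by
        simp only [hA, ContinuousLinearMap.coe_coe, sub_apply]
        rw [hT0 _ h1, (Submodule.starProjection_apply_eq_zero_iff S).2 h1, sub_zero]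
      rw [map_sub, sub_eq_zero] at h2
      simp [h2]
    · exact LinearMap.range_comp_le_range _ _
  have hker : LinearMap.ker (A.comp S.subtype) = F.comap S.subtype := by
    ext ⟨w, hw⟩
    have := Submodule.starProjection_eq_self_iff.2 hw
    simp only [LinearMap.mem_ker, Submodule.mem_comap, Submodule.subtype_apply, hF, hA,
      LinearMap.comp_apply, ContinuousLinearMap.coe_coe, sub_apply, this, sub_eq_zero]
    exact eq_comm
  have := LinearMap.finrank_range_add_finrank_ker (A.comp S.subtype)
  rw [hker, ← hrange] at this
  rw [← this]
  congr 1
  exact (Submodule.comapSubtypeEquivOfLe hFS).finrank_eq.symm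

end Projections

/-! ### Coordinate permutations -/

/-- The operator that permutes the coordinates: `(permOp f w) p = w (f p)`. -/
def permOp {κ : Type*} [Fintype κ] (f : κ → κ) : EuclideanSpace ℂ κ →L[ℂ] EuclideanSpace ℂ κ :=
  LinearMap.toContinuousLinearMap
    { toFun := fun w => WithLp.toLp 2 fun p => w (f p)
      map_add' := fun _ _ => rfl
      map_smul' := fun _ _ => rfl }

section PermOp

variable {κ : Type*}

@[simp] theorem permOp_apply [Fintype κ] (f : κ → κ) (w : EuclideanSpace ℂ κ) (p : κ) :
    permOp f w p = w (f p) := rfl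

theorem mem_invariantUnder {f : κ → κ} {ε : ℂ} {w : EuclideanSpace ℂ κ} :
    w ∈ invariantUnder f ε ↔ ∀ p, w (f p) = ε * w p := Iff.rfl

theorem inner_permOp_left [Fintype κ] {f g : κ → κ} (h1 : ∀ p, f (g p) = p) (h2 : ∀ p, g (f p) = p)
    (v w : EuclideanSpace ℂ κ) : ⟪permOp f v, w⟫_ℂ = ⟪v, permOp g w⟫_ℂ := by
  simp only [PiLp.inner_apply, permOp_apply]
  exact Fintype.sum_equiv ⟨f, g, h2, h1⟩ _ _ fun p => by simp [h2]

theorem trace_permOp [Fintype κ] [DecidableEq κ] (f : κ → κ) :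
    LinearMap.trace ℂ _ (permOp f).toLinearMap =
      ((Finset.univ.filter fun p => f p = p).card : ℂ) := by
  rw [LinearMap.trace_eq_matrix_trace ℂ (EuclideanSpace.basisFun κ ℂ).toBasis, Matrix.trace,
    Finset.card_filter, Nat.cast_sum]
  refine Finset.sum_congr rfl fun p _ => ?_
  simp [LinearMap.toMatrix_apply]

/-- The vectors that are constant on the fibres of a surjection onto `Q` form a space of dimension
`#Q`. -/
theorem finrank_of_mem_iff_fibres {Q : Type*} [Fintype Q] {q : κ → Q} (hq : Function.Surjective q)
    {S : Submodule ℂ (EuclideanSpace ℂ κ)} (hS : ∀ w, w ∈ S ↔ ∀ p p', q p = q p' → w p = w p') :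
    Module.finrank ℂ S = Fintype.card Q := by
  rw [← Module.finrank_fintype_fun_eq_card (R := ℂ)]
  symm
  refine LinearEquiv.finrank_eq (LinearEquiv.ofBijective
    { toFun := fun c : Q → ℂ => (⟨WithLp.toLp 2 fun p => c (q p), (hS _).2 fun p p' h => by
        simp [h]⟩ : S)
      map_add' := fun _ _ => rfl
      map_smul' := fun _ _ => rfl } ⟨?_, ?_⟩)
  · intro c c' h
    ext z
    obtain ⟨p, rfl⟩ := hq z
    exact congrArg (fun v : S => (v : EuclideanSpace ℂ κ) p) h
  · rintro ⟨w, hw⟩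
    refine ⟨fun z => w (Function.surjInv hq z), Subtype.ext ?_⟩
    ext p
    exact (hS w).1 hw _ _ (Function.surjInv_eq hq _)

end PermOp

/-! ### The tensor square of a subspace -/

section TensorSquare

variable {ι : Type*}

/-- The coordinates of `∑ c a b • (e a ⊗ e b)`, as a linear function of the coefficients `c`. -/
def tensorExpand {n : ℕ} (e : Fin n → EuclideanSpace ℂ ι) :
    EuclideanSpace ℂ (Fin n × Fin n) →ₗ[ℂ] EuclideanSpace ℂ (ι × ι) where
  toFun c := WithLp.toLp 2 fun p => ∑ a, ∑ b, c (a, b) * (e a p.1 * e b p.2)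
  map_add' c c' := by
    ext p
    simp [add_mul, Finset.sum_add_distrib]
  map_smul' r c := by
    ext p
    simp [Finset.mul_sum, mul_assoc]

theorem tensorExpand_apply {n : ℕ} (e : Fin n → EuclideanSpace ℂ ι)
    (c : EuclideanSpace ℂ (Fin n × Fin n)) (p : ι × ι) :
    tensorExpand e c p = ∑ a, ∑ b, c (a, b) * (e a p.1 * e b p.2) := rfl

theorem tens_mem_tensorSq {H : Submodule ℂ (EuclideanSpace ℂ ι)} {u v : EuclideanSpace ℂ ι}
    (hu : u ∈ H) (hv : v ∈ H) : tens u v ∈ tensorSq H :=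
  Submodule.subset_span ⟨u, hu, v, hv, rfl⟩

variable [Fintype ι]

/-- `H ⊗ H` consists of the arrays all of whose columns and rows belong to `H`. -/
theorem mem_tensorSq {H : Submodule ℂ (EuclideanSpace ℂ ι)} {w : EuclideanSpace ℂ (ι × ι)} :
    w ∈ tensorSq H ↔ (∀ q, WithLp.toLp 2 (fun p => w (p, q)) ∈ H) ∧
      ∀ p, WithLp.toLp 2 (fun q => w (p, q)) ∈ H := by
  constructor
  · intro hw
    induction hw using Submodule.span_induction with
    | mem x hx =>
      obtain ⟨u, hu, v, hv, rfl⟩ := hx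
      refine ⟨fun q => ?_, fun p => ?_⟩
      · convert H.smul_mem (v q) hu using 1
        ext p
        simp [tens, mul_comm]
      · exact H.smul_mem (u p) hv
    | zero => exact ⟨fun q => H.zero_mem, fun p => H.zero_mem⟩
    | add x y _ _ hx hy =>
      exact ⟨fun q => H.add_mem (hx.1 q) (hy.1 q), fun p => H.add_mem (hx.2 p) (hy.2 p)⟩
    | smul a x _ hx => exact ⟨fun q => H.smul_mem a (hx.1 q), fun p => H.smul_mem a (hx.2 p)⟩
  · rintro ⟨hcol, hrow⟩
    -- Expand every column in an orthonormal basis of `H`; the coefficients, as functions of the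
    -- column index, are linear combinations of rows.
    let b := stdOrthonormalBasis ℂ H
    let c : Fin (Module.finrank ℂ H) → EuclideanSpace ℂ ι := fun a =>
      WithLp.toLp 2 fun q => ⟪(b a : EuclideanSpace ℂ ι), WithLp.toLp 2 (fun p => w (p, q))⟫_ℂ
    have hc : ∀ a, c a ∈ H := fun a => by
      have : c a = ∑ p, starRingEnd ℂ ((b a : EuclideanSpace ℂ ι) p) •
          (WithLp.toLp 2 (fun q => w (p, q)) : EuclideanSpace ℂ ι) := by
        ext q
        simp [c, PiLp.inner_apply, mul_comm]
      rw [this]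
      exact H.sum_mem fun p _ => H.smul_mem _ (hrow p)
    have hw : w = ∑ a, tens (b a : EuclideanSpace ℂ ι) (c a) := by
      ext ⟨p, q⟩
      have := congrArg (fun v : H => (v : EuclideanSpace ℂ ι) p) (b.sum_repr' ⟨_, hcol q⟩)
      simpa [tens, c, mul_comm] using this.symm
    rw [hw]
    exact Submodule.sum_mem _ fun a _ => tens_mem_tensorSq (b a).2 (hc a)

theorem tensorSq_top : tensorSq (⊤ : Submodule ℂ (EuclideanSpace ℂ ι)) = ⊤ :=
  Submodule.eq_top_iff'.2 fun _ => mem_tensorSq.2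
    ⟨fun _ => Submodule.mem_top, fun _ => Submodule.mem_top⟩

variable {n : ℕ} {H : Submodule ℂ (EuclideanSpace ℂ ι)}

theorem tensorExpand_injective (b : OrthonormalBasis (Fin n) ℂ H) :
    Function.Injective (tensorExpand fun a => (b a : EuclideanSpace ℂ ι)) := by
  have hli : LinearIndependent ℂ fun a => (b a : EuclideanSpace ℂ ι) :=
    b.toBasis.linearIndependent.map' H.subtype (Submodule.ker_subtype H)
  rw [← LinearMap.ker_eq_bot, LinearMap.ker_eq_bot']
  intro c hc
  rw [Fintype.linearIndependent_iff] at hli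
  ext ⟨a, a'⟩
  have h1 : ∀ q a, ∑ b', c (a, b') * (b b' : EuclideanSpace ℂ ι) q = 0 := by
    intro q
    refine hli _ ?_
    ext p
    have := congrArg (fun w : EuclideanSpace ℂ (ι × ι) => w (p, q)) hc
    simp only [tensorExpand_apply, PiLp.zero_apply] at this
    simp only [WithLp.ofLp_sum, WithLp.ofLp_smul, Finset.sum_apply, Pi.smul_apply, smul_eq_mul,
      PiLp.zero_apply]
    rw [← this]
    refine Finset.sum_congr rfl fun a _ => ?_
    rw [Finset.sum_mul]
    exact Finset.sum_congr rfl fun b' _ => by ring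
  refine hli (fun b' => c (a, b')) ?_ a'
  ext q
  simpa using h1 q a

theorem range_tensorExpand (b : OrthonormalBasis (Fin n) ℂ H) :
    LinearMap.range (tensorExpand fun a => (b a : EuclideanSpace ℂ ι)) = tensorSq H := by
  apply le_antisymm
  · rintro _ ⟨c, rfl⟩
    have : tensorExpand (fun a => (b a : EuclideanSpace ℂ ι)) c =
        ∑ a, ∑ a', c (a, a') • tens (b a : EuclideanSpace ℂ ι) (b a') := by
      ext p
      simp [tensorExpand_apply, tens]
    rw [this]
    exact Submodule.sum_mem _ fun a _ => Submodule.sum_mem _ fun a' _ =>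
      Submodule.smul_mem _ _ (tens_mem_tensorSq (b a).2 (b a').2)
  · refine Submodule.span_le.2 ?_
    rintro _ ⟨u, hu, v, hv, rfl⟩
    refine ⟨tens (b.repr ⟨u, hu⟩) (b.repr ⟨v, hv⟩), ?_⟩
    ext ⟨p, q⟩
    have h1 := congrArg (fun v : H => (v : EuclideanSpace ℂ ι) p) (b.sum_repr ⟨u, hu⟩)
    have h2 := congrArg (fun v : H => (v : EuclideanSpace ℂ ι) q) (b.sum_repr ⟨v, hv⟩)
    simp only [Submodule.coe_sum, Submodule.coe_smul, WithLp.ofLp_sum, WithLp.ofLp_smul,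
      Finset.sum_apply, Pi.smul_apply, smul_eq_mul] at h1 h2
    simp only [tensorExpand_apply, tens]
    rw [← h1, ← h2, Finset.sum_mul_sum]
    exact Finset.sum_congr rfl fun a _ => Finset.sum_congr rfl fun a' _ => by ring

theorem finrank_tensorSq (H : Submodule ℂ (EuclideanSpace ℂ ι)) :
    Module.finrank ℂ (tensorSq H) = Module.finrank ℂ H ^ 2 := by
  let b := stdOrthonormalBasis ℂ H
  rw [← range_tensorExpand b, LinearMap.finrank_range_of_inj (tensorExpand_injective b)]
  simp [sq]

theorem mem_invariantUnder_swap {κ : Type*} {w : EuclideanSpace ℂ (κ × κ)} :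
    w ∈ invariantUnder Prod.swap 1 ↔ ∀ p q, w (q, p) = w (p, q) := by
  simp [mem_invariantUnder]

theorem finrank_symSq (H : Submodule ℂ (EuclideanSpace ℂ ι)) :
    Module.finrank ℂ (symSq H) = (Module.finrank ℂ H + 1).choose 2 := by
  let b := stdOrthonormalBasis ℂ H
  set J := tensorExpand fun a => (b a : EuclideanSpace ℂ ι) with hJ
  have hinj : Function.Injective J := tensorExpand_injective b
  have hswap : ∀ c p q, J c (q, p) = J (permOp Prod.swap c) (p, q) := by
    intro c p q
    simp only [hJ, tensorExpand_apply, permOp_apply, Prod.swap_prod_mk]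
    rw [Finset.sum_comm]
    exact Finset.sum_congr rfl fun a _ => Finset.sum_congr rfl fun a' _ => by ring
  have hmap : symSq H = (invariantUnder Prod.swap 1).map J := by
    ext w
    rw [symSq, Submodule.mem_inf, ← range_tensorExpand b]
    constructor
    · rintro ⟨⟨c, rfl⟩, hw⟩
      refine ⟨c, ?_, rfl⟩
      have : permOp Prod.swap c = c := hinj (by
        ext ⟨p, q⟩
        rw [← hswap]
        exact mem_invariantUnder_swap.1 hw p q)
      exact mem_invariantUnder.2 fun p => by
        rw [one_mul]
        exact congrArg (fun w : EuclideanSpace ℂ (_ × _) => w p) this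
    · rintro ⟨c, hc, rfl⟩
      refine ⟨⟨c, rfl⟩, mem_invariantUnder_swap.2 fun p q => ?_⟩
      have : permOp Prod.swap c = c := by
        ext p
        simpa using mem_invariantUnder.1 hc p
      rw [hswap, this]
  rw [hmap, LinearEquiv.finrank_eq (Submodule.equivMapOfInjective J hinj _).symm,
    finrank_of_mem_iff_fibres (q := fun p : Fin _ × Fin _ => s(p.1, p.2)) (Q := Sym2 (Fin _)),
    Sym2.card, Fintype.card_fin]
  · rintro ⟨a, a'⟩
    exact ⟨(a, a'), rfl⟩
  · intro w
    rw [mem_invariantUnder_swap]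
    constructor
    · rintro h ⟨p, q⟩ ⟨p', q'⟩ hpq
      rcases Sym2.eq_iff.1 hpq with ⟨h1, h2⟩ | ⟨h1, h2⟩
      · simp only at h1 h2
        rw [h1, h2]
      · simp only at h1 h2
        rw [h1, h2, h]
    · intro h p q
      exact h _ _ Sym2.eq_swap

/-- The projection on `H ⊗ H` maps swap-invariant vectors to swap-invariant vectors. -/
theorem starProjection_tensorSq_mem_invariantUnder_swap {w : EuclideanSpace ℂ (ι × ι)}
    (hw : w ∈ invariantUnder Prod.swap 1) :
    (tensorSq H).starProjection w ∈ invariantUnder Prod.swap 1 := by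
  have hsw : ∀ v : EuclideanSpace ℂ (ι × ι), v ∈ invariantUnder Prod.swap 1 ↔
      permOp Prod.swap v = v := fun v => by
    rw [mem_invariantUnder]
    exact ⟨fun h => by ext p; simpa using h p, fun h p => by
      rw [one_mul]; exact congrArg (fun w : EuclideanSpace ℂ (_ × _) => w p) h⟩
  have ht : ∀ v ∈ tensorSq H, permOp Prod.swap v ∈ tensorSq H := fun v hv =>
    mem_tensorSq.2 ⟨(mem_tensorSq.1 hv).2, (mem_tensorSq.1 hv).1⟩
  rw [hsw] at hw ⊢
  symm
  refine Submodule.eq_starProjection_of_mem_of_inner_eq_zero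
    (ht _ (Submodule.starProjection_apply_mem _ _)) fun v hv => ?_
  nth_rewrite 1 [← hw]
  rw [← map_sub, inner_permOp_left (g := Prod.swap) (fun _ => rfl) (fun _ => rfl)]
  exact Submodule.starProjection_inner_eq_zero _ _ (ht v hv)

theorem compress_starProjection_symSq :
    compress H (symSq H).starProjection = (symSq H).starProjection :=
  starProjection_mul_mul_of_le inf_le_left

theorem compress_sub (H : Submodule ℂ (EuclideanSpace ℂ ι))
    (S T : EuclideanSpace ℂ (ι × ι) →L[ℂ] EuclideanSpace ℂ (ι × ι)) :
    compress H (S - T) = compress H S - compress H T := by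
  simp only [compress, mul_sub, sub_mul]

theorem inner_compress_left {T : EuclideanSpace ℂ (ι × ι) →L[ℂ] EuclideanSpace ℂ (ι × ι)}
    (hT : ∀ v w, ⟪T v, w⟫_ℂ = ⟪v, T w⟫_ℂ) (v w : EuclideanSpace ℂ (ι × ι)) :
    ⟪compress H T v, w⟫_ℂ = ⟪v, compress H T w⟫_ℂ := by
  simp only [compress, mul_apply_eq_comp]
  rw [Submodule.inner_starProjection_left_eq_right, hT,
    Submodule.inner_starProjection_left_eq_right]

theorem compress_mem_symSq {T : EuclideanSpace ℂ (ι × ι) →L[ℂ] EuclideanSpace ℂ (ι × ι)}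
    (hT : ∀ w, T w ∈ invariantUnder Prod.swap 1) (w : EuclideanSpace ℂ (ι × ι)) :
    compress H T w ∈ symSq H :=
  ⟨Submodule.starProjection_apply_mem _ _,
    starProjection_tensorSq_mem_invariantUnder_swap (hT _)⟩

/-- A row of the table follows from the dimension of `H` and of the space of fixed vectors of `T`,
when `A = P_{Sym² H} - T`. -/
theorem tableRow_of_fixed {A T : EuclideanSpace ℂ (ι × ι) →L[ℂ] EuclideanSpace ℂ (ι × ι)}
    {F : Submodule ℂ (EuclideanSpace ℂ (ι × ι))} {N : ℕ} {y : ℝ}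
    (hA : A = (symSq H).starProjection - T) (hsymm : ∀ v w, ⟪T v, w⟫_ℂ = ⟪v, T w⟫_ℂ)
    (hmem : ∀ w, T w ∈ symSq H) (hF : ∀ w, w ∈ F ↔ T w = w)
    (hN : Module.finrank ℂ H = N) (hN0 : 0 < N)
    (hy : (Module.finrank ℂ F : ℝ) = y * (N * (N + 1) / 2)) : TableRow H A N y := by
  have hS : (Module.finrank ℂ (symSq H) : ℝ) = N * (N + 1) / 2 := by
    rw [finrank_symSq, hN, Nat.cast_choose_two]
    push_cast
    ring
  have hS0 : (0 : ℝ) < N * (N + 1) / 2 := by positivity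
  have hX : 1 - X H A = y := by
    have h := finrank_range_starProjection_sub hsymm hmem hF
    rw [← hA] at h
    have h' : (Module.finrank ℂ (LinearMap.range A.toLinearMap) : ℝ) + Module.finrank ℂ F =
        Module.finrank ℂ (symSq H) := by exact_mod_cast h
    rw [hy, hS] at h'
    rw [X, hS, eq_sub_of_add_eq h', sub_div, mul_div_cancel_right₀ _ hS0.ne', div_self hS0.ne',
      sub_sub_cancel]
  refine ⟨hN, hX, ?_⟩
  rw [Pcr, hX]
  congr 1
  linarith

end TensorSquare

/-! ### Permutations of the `2L` tensor factors -/

section Slots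

variable {d L : ℕ}

/-- The action of a permutation of the `2L` tensor factors on pairs of multi-indices; the factors of
the first copy are labelled by `Sum.inl`, those of the second copy by `Sum.inr`. -/
def slotPerm (g : Equiv.Perm (Fin L ⊕ Fin L)) (p : Idx d L × Idx d L) : Idx d L × Idx d L :=
  (fun i => Sum.elim p.1 p.2 (g (Sum.inl i)), fun i => Sum.elim p.1 p.2 (g (Sum.inr i)))

theorem elim_slotPerm (g : Equiv.Perm (Fin L ⊕ Fin L)) (p : Idx d L × Idx d L)
    (a : Fin L ⊕ Fin L) :
    Sum.elim (slotPerm g p).1 (slotPerm g p).2 a = Sum.elim p.1 p.2 (g a) := by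
  cases a <;> rfl

theorem slotPerm_slotPerm (g h : Equiv.Perm (Fin L ⊕ Fin L)) (p : Idx d L × Idx d L) :
    slotPerm h (slotPerm g p) = slotPerm (g * h) p :=
  Prod.ext (funext fun _ => elim_slotPerm g p _) (funext fun _ => elim_slotPerm g p _)

theorem slotPerm_one (p : Idx d L × Idx d L) : slotPerm 1 p = p := rfl

theorem slotPerm_sumCongr (σ τ : Equiv.Perm (Fin L)) (p : Idx d L × Idx d L) :
    slotPerm (Equiv.Perm.sumCongr σ τ) p = (p.1 ∘ σ, p.2 ∘ τ) := rfl

variable (d) in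
/-- The operator on the `2L` tensor factors given by a permutation of the factors. -/
def slotOp (g : Equiv.Perm (Fin L ⊕ Fin L)) : Op₂ d L := permOp (slotPerm g)

@[simp] theorem slotOp_apply (g : Equiv.Perm (Fin L ⊕ Fin L))
    (w : EuclideanSpace ℂ (Idx d L × Idx d L)) (p : Idx d L × Idx d L) :
    slotOp d g w p = w (slotPerm g p) := rfl

theorem slotOp_mul (g h : Equiv.Perm (Fin L ⊕ Fin L)) :
    slotOp d (g * h) = slotOp d g * slotOp d h := by
  ext w p
  simp [slotPerm_slotPerm]

theorem slotOp_one : slotOp d (1 : Equiv.Perm (Fin L ⊕ Fin L)) = 1 := rfl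

theorem inner_slotOp_left (g : Equiv.Perm (Fin L ⊕ Fin L))
    (v w : EuclideanSpace ℂ (Idx d L × Idx d L)) :
    ⟪slotOp d g v, w⟫_ℂ = ⟪v, slotOp d g⁻¹ w⟫_ℂ :=
  inner_permOp_left (fun p => by rw [slotPerm_slotPerm, inv_mul_cancel, slotPerm_one])
    (fun p => by rw [slotPerm_slotPerm, mul_inv_cancel, slotPerm_one]) v w

/-- The permutation of the `2L` factors that interchanges `i` and `i'` for all `i ∈ S`. -/
def rowSwap (S : Finset (Fin L)) : Equiv.Perm (Fin L ⊕ Fin L) :=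
  Function.Involutive.toPerm
    (Sum.elim (fun i => if i ∈ S then Sum.inr i else Sum.inl i)
      fun i => if i ∈ S then Sum.inl i else Sum.inr i) <| by
    rintro (i | i) <;> by_cases h : i ∈ S <;> simp [h]

theorem rowSwap_inl (S : Finset (Fin L)) (i : Fin L) :
    rowSwap S (Sum.inl i) = if i ∈ S then Sum.inr i else Sum.inl i := rfl

theorem rowSwap_inr (S : Finset (Fin L)) (i : Fin L) :
    rowSwap S (Sum.inr i) = if i ∈ S then Sum.inl i else Sum.inr i := rfl

theorem rowSwap_mul (S T : Finset (Fin L)) : rowSwap S * rowSwap T = rowSwap (symmDiff S T) := by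
  ext a : 1
  rcases a with i | i <;> by_cases h : i ∈ S <;> by_cases h' : i ∈ T <;>
    simp [rowSwap_inl, rowSwap_inr, h, h', Finset.mem_symmDiff]

theorem rowSwap_inv (S : Finset (Fin L)) : (rowSwap S)⁻¹ = rowSwap S := rfl

theorem rowSwap_empty : rowSwap (∅ : Finset (Fin L)) = 1 := by
  ext a : 1
  rcases a with i | i <;> simp [rowSwap_inl, rowSwap_inr]

theorem rowSwap_singleton (b : Fin L) : rowSwap {b} = Equiv.swap (Sum.inl b) (Sum.inr b) := by
  ext a : 1
  rcases a with i | i <;> by_cases hi : i = b <;>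
    simp [rowSwap_inl, rowSwap_inr, hi, Equiv.swap_apply_of_ne_of_ne]

theorem slotPerm_rowSwap (S : Finset (Fin L)) (p : Idx d L × Idx d L) :
    slotPerm (rowSwap S) p = (S.piecewise p.2 p.1, S.piecewise p.1 p.2) := by
  ext i <;> by_cases h : i ∈ S <;> simp [slotPerm, rowSwap_inl, rowSwap_inr, h]

theorem slotPerm_rowSwap_univ : slotPerm (d := d) (rowSwap (Finset.univ : Finset (Fin L))) =
    Prod.swap := by
  ext p i <;> simp [slotPerm_rowSwap]

theorem pairProj_eq (i : Fin L) :
    pairProj d L i = (2⁻¹ : ℂ) • (1 + slotOp d (rowSwap {i})) := by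
  have hf : (fun p : Idx d L × Idx d L =>
      (Function.update p.1 i (p.2 i), Function.update p.2 i (p.1 i))) =
      slotPerm (rowSwap {i}) := by
    funext p
    rw [slotPerm_rowSwap, Finset.piecewise_singleton, Finset.piecewise_singleton]
  simp only [pairProj, hf]
  symm
  refine eq_starProjection_of_symmetric (fun v w => ?_) (fun w => ?_) fun w hw => ?_
  · simp only [smul_apply, add_apply, one_apply_eq_self, inner_add_left, inner_add_right,
      inner_smul_left, inner_smul_right, inner_slotOp_left, rowSwap_inv]
    rw [map_inv₀, map_ofNat]
  · intro p
    simp [slotPerm_slotPerm, rowSwap_mul, rowSwap_empty, slotPerm_one, add_comm]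
  · ext p
    have := mem_invariantUnder.1 hw p
    simp only [smul_apply, add_apply, PiLp.smul_apply,
      PiLp.add_apply, one_apply_eq_self, slotOp_apply, this, smul_eq_mul]
    ring

/-- `P⁺_{11'} ⋯ P⁺_{LL'}` is the average of all interchanges of corresponding factors. -/
theorem pairProjProd_eq :
    pairProjProd d L = ((2 : ℂ) ^ L)⁻¹ • ∑ S : Finset (Fin L), slotOp d (rowSwap S) := by
  have key : ∀ l : List (Fin L), l.Nodup → (l.map (pairProj d L)).prod =
      ((2 : ℂ) ^ l.length)⁻¹ • ∑ S ∈ l.toFinset.powerset, slotOp d (rowSwap S) := by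
    intro l hl
    induction l with
    | nil => simp [rowSwap_empty, slotOp_one]
    | cons i l ih =>
      rw [List.nodup_cons] at hl
      have hi : i ∉ l.toFinset := by simpa using hl.1
      rw [List.map_cons, List.prod_cons, ih hl.2, List.toFinset_cons,
        Finset.sum_powerset_insert hi, pairProj_eq, smul_mul_smul_comm, add_mul, one_mul,
        Finset.mul_sum]
      congr 1
      · rw [List.length_cons, pow_succ, mul_inv, mul_comm]
      · congr 1
        refine Finset.sum_congr rfl fun S hS => ?_
        rw [← slotOp_mul, rowSwap_mul]
        congr 2
        have : i ∉ S := fun h => hi (Finset.mem_powerset.1 hS h)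
        ext j
        rw [Finset.mem_symmDiff, Finset.mem_singleton, Finset.mem_insert]
        grind
  rw [pairProjProd, List.ofFn_eq_map, key _ (List.nodup_finRange L), List.length_finRange,
    List.toFinset_finRange, Finset.powerset_univ]

theorem slotOp_rowSwap_mul_pairProjProd (S : Finset (Fin L)) :
    slotOp d (rowSwap S) * pairProjProd d L = pairProjProd d L := by
  rw [pairProjProd_eq, mul_smul_comm, Finset.mul_sum]
  congr 1
  refine Fintype.sum_equiv (symmDiff_left_involutive S).toPerm _ _ fun T => ?_
  rw [← slotOp_mul, rowSwap_mul, symmDiff_comm]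
  rfl

variable (d L) in
/-- The vectors that are symmetric under the interchange of `i` and `i'`, for every `i`. -/
def pairSym : Submodule ℂ (EuclideanSpace ℂ (Idx d L × Idx d L)) :=
  ⨅ S : Finset (Fin L), invariantUnder (slotPerm (rowSwap S)) 1

theorem mem_pairSym {w : EuclideanSpace ℂ (Idx d L × Idx d L)} :
    w ∈ pairSym d L ↔ ∀ S p, w (slotPerm (rowSwap S) p) = w p := by
  simp [pairSym, mem_invariantUnder]

theorem pairProjProd_eq_starProjection : pairProjProd d L = (pairSym d L).starProjection := by
  refine eq_starProjection_of_symmetric (fun v w => ?_) (fun w => ?_) fun w hw => ?_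
  · simp only [pairProjProd_eq, smul_apply, sum_apply, inner_smul_left, inner_smul_right,
      sum_inner, inner_sum, inner_slotOp_left, rowSwap_inv]
    rw [map_inv₀, map_pow, map_ofNat]
  · refine mem_pairSym.2 fun S p => ?_
    conv_rhs => rw [← slotOp_rowSwap_mul_pairProjProd S]
    rfl
  · have h : ∀ S, slotOp d (rowSwap S) w = w := fun S => by
      ext p; exact mem_pairSym.1 hw S p
    have hc : (Fintype.card (Finset (Fin L)) : ℂ) = 2 ^ L := by simp
    rw [pairProjProd_eq, smul_apply, sum_apply,
      Finset.sum_congr rfl fun S _ => h S, Finset.sum_const, Finset.card_univ,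
      ← Nat.cast_smul_eq_nsmul ℂ, hc, smul_smul, inv_mul_cancel₀ (pow_ne_zero _ two_ne_zero),
      one_smul]

theorem pairSym_le : pairSym d L ≤ invariantUnder Prod.swap 1 := fun w hw p => by
  have := mem_pairSym.1 hw Finset.univ p
  rwa [slotPerm_rowSwap_univ, ← one_mul (w p)] at this

theorem inner_pairProjProd_left (v w : EuclideanSpace ℂ (Idx d L × Idx d L)) :
    ⟪pairProjProd d L v, w⟫_ℂ = ⟪v, pairProjProd d L w⟫_ℂ := by
  rw [pairProjProd_eq_starProjection, Submodule.inner_starProjection_left_eq_right]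

theorem pairProjProd_mem_invariantUnder_swap (w : EuclideanSpace ℂ (Idx d L × Idx d L)) :
    pairProjProd d L w ∈ invariantUnder Prod.swap 1 := by
  rw [pairProjProd_eq_starProjection]
  exact pairSym_le (Submodule.starProjection_apply_mem _ _)

end Slots

/-! ### Separable states -/

theorem finrank_pairSym (d L : ℕ) :
    Module.finrank ℂ (pairSym d L) = ((d + 1).choose 2) ^ L := by
  rw [finrank_of_mem_iff_fibres (Q := Fin L → Sym2 (Fin d))
    (q := fun p : Idx d L × Idx d L => fun i => s(p.1 i, p.2 i))]
  · simp [Sym2.card]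
  · intro z
    choose f hf using fun i => Quot.exists_rep (z i)
    exact ⟨(fun i => (f i).1, fun i => (f i).2), funext hf⟩
  · intro w
    rw [mem_pairSym]
    constructor
    · rintro h ⟨x, y⟩ ⟨x', y'⟩ hp
      rw [← h (Finset.univ.filter fun i => x i ≠ x' i) (x, y), slotPerm_rowSwap]
      refine congrArg w (Prod.ext ?_ ?_)
      · funext i
        have := Sym2.eq_iff.1 (congrFun hp i)
        by_cases hi : x i = x' i <;> simp [hi]
        tauto
      · funext i
        have := Sym2.eq_iff.1 (congrFun hp i)
        by_cases hi : x i = x' i <;> simp [hi]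
        · rcases this with h | h
          · exact h.2
          · exact h.2.trans (hi.symm.trans h.1)
        · tauto
    · intro h S p
      refine h _ _ (funext fun i => ?_)
      by_cases hi : i ∈ S <;> simp [slotPerm_rowSwap, hi, Sym2.eq_swap]

theorem tableRow_separable (d L : ℕ) (hd : 1 ≤ d) :
    TableRow ⊤ (sepA d L) (d ^ L)
      ((2 : ℝ) ^ (1 - (L : ℤ)) * (((d : ℝ) + 1) ^ L / ((d : ℝ) ^ L + 1))) := by
  refine tableRow_of_fixed (T := pairProjProd d L) (F := pairSym d L) rfl inner_pairProjProd_left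
    (fun w => ⟨by simp [tensorSq_top], pairProjProd_mem_invariantUnder_swap w⟩)
    (fun w => ?_) (by simp) (by positivity) ?_
  · rw [pairProjProd_eq_starProjection, Submodule.starProjection_eq_self_iff]
  · rw [finrank_pairSym, zpow_sub₀ two_ne_zero, zpow_one, zpow_natCast]
    push_cast [Nat.cast_choose_two]
    rw [show ((d : ℝ) + 1) * ((d : ℝ) + 1 - 1) / 2 = (d + 1) * d / 2 by ring, div_pow, mul_pow]
    field_simp

/-! ### Separable bosonic states -/

theorem mem_bosonSpace {d L : ℕ} {w : EuclideanSpace ℂ (Idx d L)} :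
    w ∈ bosonSpace d L ↔ ∀ (σ : Equiv.Perm (Fin L)) x, w (x ∘ σ) = w x := by
  simp [bosonSpace, mem_invariantUnder]

/-- Two families that agree as multisets differ by a permutation of the index set. -/
theorem exists_perm_of_map_univ_eq {α β : Type*} [Fintype α] [DecidableEq β] {x y : α → β}
    (h : Finset.univ.val.map x = Finset.univ.val.map y) : ∃ σ : Equiv.Perm α, x ∘ σ = y := by
  have hcard : ∀ b, Fintype.card {a // y a = b} = Fintype.card {a // x a = b} := fun b => by
    have := congrArg (Multiset.count b) h
    rw [Multiset.count_map, Multiset.count_map] at this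
    simp only [Fintype.card_subtype, Finset.card_def, Finset.filter_val]
    simpa only [eq_comm] using this.symm
  let e : ∀ b, {a // y a = b} ≃ {a // x a = b} := fun b => Fintype.equivOfCardEq (hcard b)
  refine ⟨(Equiv.sigmaFiberEquiv y).symm.trans
    ((Equiv.sigmaCongrRight e).trans (Equiv.sigmaFiberEquiv x)), ?_⟩
  funext a
  exact (e (y a) ⟨a, rfl⟩).2

theorem finrank_bosonSpace (d L : ℕ) :
    Module.finrank ℂ (bosonSpace d L) = (d + L - 1).choose L := by
  rw [finrank_of_mem_iff_fibres (Q := Sym (Fin d) L)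
    (q := fun x : Idx d L => (⟨Finset.univ.val.map x, by simp⟩ : Sym (Fin d) L)),
    Sym.card_sym_eq_choose, Fintype.card_fin]
  · rintro ⟨m, hm⟩
    induction m using Quotient.inductionOn with
    | h l =>
      have hl : l.length = L := hm
      subst hl
      exact ⟨l.get, Subtype.ext (by simp)⟩
  · intro w
    rw [mem_bosonSpace]
    constructor
    · intro h x y hxy
      obtain ⟨σ, rfl⟩ := exists_perm_of_map_univ_eq (x := x) (y := y) (congrArg Subtype.val hxy)
      exact (h σ x).symm
    · intro h σ x
      refine h _ _ (Subtype.ext ?_)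
      have := Multiset.map_univ_val_equiv σ
      simp only [← Multiset.map_map, this]

theorem mem_tensorSq_bosonSpace {d L : ℕ} {w : EuclideanSpace ℂ (Idx d L × Idx d L)} :
    w ∈ tensorSq (bosonSpace d L) ↔ ∀ (σ τ : Equiv.Perm (Fin L)) p,
      w (slotPerm (Equiv.Perm.sumCongr σ τ) p) = w p := by
  simp only [mem_tensorSq, mem_bosonSpace, slotPerm_sumCongr]
  constructor
  · rintro ⟨h1, h2⟩ σ τ p
    exact (h1 (p.2 ∘ τ) σ p.1).trans (h2 p.1 τ p.2)
  · intro h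
    exact ⟨fun q σ x => h σ 1 (x, q), fun p τ y => h 1 τ (p, y)⟩


theorem mem_tensorSq_bosonSpace_inf_pairSym {d L : ℕ}
    {w : EuclideanSpace ℂ (Idx d L × Idx d L)} :
    w ∈ tensorSq (bosonSpace d L) ⊓ pairSym d L ↔
      ∀ (g : Equiv.Perm (Fin L ⊕ Fin L)) p, w (slotPerm g p) = w p := by
  rw [Submodule.mem_inf, mem_tensorSq_bosonSpace, mem_pairSym]
  constructor
  · rintro ⟨h1, h2⟩ g
    have hmul : ∀ g h : Equiv.Perm (Fin L ⊕ Fin L), (∀ p, w (slotPerm g p) = w p) →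
        (∀ p, w (slotPerm h p) = w p) → ∀ p, w (slotPerm (g * h) p) = w p := by
      intro g h hg hh p
      rw [← slotPerm_slotPerm, hh, hg]
    have hmix : ∀ a b, ∀ p, w (slotPerm (Equiv.swap (Sum.inl a) (Sum.inr b)) p) = w p := by
      intro a b
      -- The transposition of `a` and `b'` is conjugate to the one of `b` and `b'`.
      have hconj : Equiv.swap (Sum.inl a : Fin L ⊕ Fin L) (Sum.inr b) =
          Equiv.Perm.sumCongr (Equiv.swap b a) 1 * rowSwap {b} *
            (Equiv.Perm.sumCongr (Equiv.swap b a) 1)⁻¹ := by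
        rw [rowSwap_singleton, Equiv.mul_swap_eq_swap_mul, mul_inv_cancel_right]
        simp only [Equiv.Perm.sumCongr, Equiv.sumCongr_apply, Sum.map_inl, Sum.map_inr,
          Equiv.swap_apply_left, Equiv.Perm.one_apply]
      rw [hconj]
      exact hmul _ _ (hmul _ _ (h1 _ _) (h2 _)) (h1 (Equiv.swap b a)⁻¹ 1)
    induction g using Equiv.Perm.swap_induction_on with
    | one => exact fun p => rfl
    | swap_mul f x y hxy ih =>
      refine hmul _ _ ?_ ih
      rcases x with a | a <;> rcases y with b | b
      · have := h1 (Equiv.swap a b) 1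
        rwa [Equiv.Perm.sumCongr_swap_one] at this
      · exact hmix a b
      · rw [Equiv.swap_comm]
        exact hmix b a
      · have := h1 1 (Equiv.swap a b)
        rwa [Equiv.Perm.sumCongr_one_swap] at this
  · exact fun h => ⟨fun σ τ => h _, fun S => h _⟩

theorem finrank_tensorSq_bosonSpace_inf_pairSym (d L : ℕ) :
    Module.finrank ℂ ↥(tensorSq (bosonSpace d L) ⊓ pairSym d L) =
      (d + 2 * L - 1).choose (2 * L) := by
  rw [finrank_of_mem_iff_fibres (Q := Sym (Fin d) (2 * L))
    (q := fun p : Idx d L × Idx d L =>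
      (⟨Finset.univ.val.map (Sum.elim p.1 p.2), by simp [two_mul]⟩ : Sym (Fin d) (2 * L))),
    Sym.card_sym_eq_choose, Fintype.card_fin]
  · rintro ⟨m, hm⟩
    induction m using Quotient.inductionOn with
    | h l =>
      have hl : l.length = L + L := hm.trans (two_mul L)
      let e : Fin L ⊕ Fin L ≃ Fin l.length := finSumFinEquiv.trans (finCongr hl.symm)
      refine ⟨(fun i => l.get (e (Sum.inl i)), fun i => l.get (e (Sum.inr i))),
        Subtype.ext ?_⟩
      have he : Sum.elim (fun i => l.get (e (Sum.inl i))) (fun i => l.get (e (Sum.inr i))) =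
          l.get ∘ e := by
        funext a
        cases a <;> rfl
      simp only [he, ← Multiset.map_map, Multiset.map_univ_val_equiv]
      simp
  · intro w
    rw [mem_tensorSq_bosonSpace_inf_pairSym]
    constructor
    · intro h x y hxy
      obtain ⟨g, hg⟩ := exists_perm_of_map_univ_eq (x := Sum.elim x.1 x.2) (y := Sum.elim y.1 y.2)
        (congrArg Subtype.val hxy)
      rw [← h g x]
      refine congrArg w (Prod.ext ?_ ?_)
      · exact funext fun i => congrFun hg (Sum.inl i)
      · exact funext fun i => congrFun hg (Sum.inr i)
    · intro h g p
      refine h _ _ (Subtype.ext ?_)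
      have he : Sum.elim (slotPerm g p).1 (slotPerm g p).2 = Sum.elim p.1 p.2 ∘ g :=
        funext (elim_slotPerm g p)
      simp only [he, ← Multiset.map_map, Multiset.map_univ_val_equiv]

theorem bosonA_eq (d L : ℕ) : bosonA d L =
    (symSq (bosonSpace d L)).starProjection - compress (bosonSpace d L) (pairProjProd d L) := by
  rw [bosonA, compress_sub, compress_starProjection_symSq]
  congr 1
  have h1 : symProj₁ d L * (tensorSq (bosonSpace d L)).starProjection =
      (tensorSq (bosonSpace d L)).starProjection :=
    starProjection_mul_of_le fun w hw => by
      simp only [Submodule.mem_iInf, mem_invariantUnder, one_mul]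
      exact fun σ p => mem_tensorSq_bosonSpace.1 hw σ 1 p
  have h2 : symProj₂ d L * (tensorSq (bosonSpace d L)).starProjection =
      (tensorSq (bosonSpace d L)).starProjection :=
    starProjection_mul_of_le fun w hw => by
      simp only [Submodule.mem_iInf, mem_invariantUnder, one_mul]
      exact fun τ p => mem_tensorSq_bosonSpace.1 hw 1 τ p
  simp only [compress, mul_assoc, h1, h2]

theorem tableRow_boson (d L : ℕ) (hd : 1 ≤ d) :
    TableRow (bosonSpace d L) (bosonA d L) ((d + L - 1).choose L)
      (2 * ((d + 2 * L - 1).choose (2 * L) : ℝ) /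
        (((d + L - 1).choose L : ℝ) * (((d + L - 1).choose L : ℝ) + 1))) := by
  have hpos : 0 < (d + L - 1).choose L := Nat.choose_pos (by omega)
  refine tableRow_of_fixed (F := tensorSq (bosonSpace d L) ⊓ pairSym d L) (bosonA_eq d L)
    (inner_compress_left inner_pairProjProd_left)
    (compress_mem_symSq pairProjProd_mem_invariantUnder_swap)
    (fun w => ?_) (finrank_bosonSpace d L) hpos ?_
  · simp only [compress, mul_apply_eq_comp, pairProjProd_eq_starProjection, Submodule.mem_inf]
    constructor
    · rintro ⟨h1, h2⟩
      rw [Submodule.starProjection_eq_self_iff.2 h1, Submodule.starProjection_eq_self_iff.2 h2,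
        Submodule.starProjection_eq_self_iff.2 h1]
    · intro h
      have h1 : w ∈ tensorSq (bosonSpace d L) := by
        rw [← h]; exact Submodule.starProjection_apply_mem _ _
      refine ⟨h1, ?_⟩
      rw [Submodule.starProjection_eq_self_iff.2 h1] at h
      -- Neither projection shortens `w`, so `w` lies in both ranges.
      rw [Submodule.mem_iff_norm_starProjection]
      refine le_antisymm (Submodule.norm_starProjection_apply_le _ _) ?_
      conv_lhs => rw [← h]
      exact Submodule.norm_starProjection_apply_le _ _
  · rw [finrank_tensorSq_bosonSpace_inf_pairSym]
    have : (0 : ℝ) < (d + L - 1).choose L := by exact_mod_cast hpos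
    field_simp

/-! ### The column antisymmetrizer -/

section Slater

open Equiv.Perm (sign sumCongrHom)

variable {d L : ℕ}

variable (d L) in
/-- The antisymmetrizer over the permutations that preserve the two copies. With the `2L` factors
arranged in `L` rows `{i, i'}` and two columns, these are the column permutations. -/
def colAsym : Op₂ d L :=
  ((L ! : ℂ) ^ 2)⁻¹ • ∑ s : Equiv.Perm (Fin L) × Equiv.Perm (Fin L),
    ((sign (sumCongrHom _ _ s) : ℤ) : ℂ) • slotOp d (sumCongrHom _ _ s)

theorem sign_mul_self_complex {α : Type*} [Fintype α] [DecidableEq α] (g : Equiv.Perm α) :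
    ((sign g : ℤ) : ℂ) * ((sign g : ℤ) : ℂ) = 1 := by
  rw [← Int.cast_mul, ← Units.val_mul, Int.units_mul_self, Units.val_one, Int.cast_one]

theorem slotOp_mul_colAsym (s : Equiv.Perm (Fin L) × Equiv.Perm (Fin L)) :
    slotOp d (sumCongrHom _ _ s) * colAsym d L =
      ((sign (sumCongrHom _ _ s) : ℤ) : ℂ) • colAsym d L := by
  rw [colAsym, mul_smul_comm]
  refine (congrArg (((L ! : ℂ) ^ 2)⁻¹ • ·) ?_).trans (smul_comm _ _ _)
  rw [Finset.mul_sum, Finset.smul_sum]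
  refine Fintype.sum_equiv (Equiv.mulLeft s) _ _ fun t => ?_
  rw [Equiv.coe_mulLeft, map_mul, Equiv.Perm.sign_mul, slotOp_mul, mul_smul_comm, smul_smul]
  congr 1
  push_cast
  rw [← mul_assoc, sign_mul_self_complex, one_mul]

theorem colAsym_mul_slotOp (s : Equiv.Perm (Fin L) × Equiv.Perm (Fin L)) :
    colAsym d L * slotOp d (sumCongrHom _ _ s) =
      ((sign (sumCongrHom _ _ s) : ℤ) : ℂ) • colAsym d L := by
  rw [colAsym, smul_mul_assoc]
  refine (congrArg (((L ! : ℂ) ^ 2)⁻¹ • ·) ?_).trans (smul_comm _ _ _)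
  rw [Finset.sum_mul, Finset.smul_sum]
  refine Fintype.sum_equiv (Equiv.mulRight s) _ _ fun t => ?_
  rw [Equiv.coe_mulRight, map_mul, Equiv.Perm.sign_mul, slotOp_mul, smul_mul_assoc, smul_smul]
  congr 1
  push_cast
  rw [mul_left_comm, sign_mul_self_complex, mul_one]

theorem mem_fermionSpace {w : EuclideanSpace ℂ (Idx d L)} :
    w ∈ fermionSpace d L ↔ ∀ (σ : Equiv.Perm (Fin L)) x, w (x ∘ σ) = ((sign σ : ℤ) : ℂ) * w x := by
  simp [fermionSpace, mem_invariantUnder]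

theorem mem_tensorSq_fermionSpace {w : EuclideanSpace ℂ (Idx d L × Idx d L)} :
    w ∈ tensorSq (fermionSpace d L) ↔ ∀ s p, w (slotPerm (sumCongrHom _ _ s) p) =
      ((sign (sumCongrHom (Fin L) (Fin L) s) : ℤ) : ℂ) * w p := by
  simp only [mem_tensorSq, mem_fermionSpace, Equiv.Perm.sumCongrHom_apply, slotPerm_sumCongr,
    Equiv.Perm.sign_sumCongr, Units.val_mul, Int.cast_mul]
  constructor
  · rintro ⟨h1, h2⟩ s p
    exact (h1 (p.2 ∘ s.2) s.1 p.1).trans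
      ((congrArg _ (h2 p.1 s.2 p.2)).trans (mul_assoc _ _ _).symm)
  · intro h
    exact ⟨fun q σ x => by simpa using h (σ, 1) (x, q),
      fun p τ y => by simpa using h (1, τ) (p, y)⟩

theorem colAsym_eq_starProjection :
    colAsym d L = (tensorSq (fermionSpace d L)).starProjection := by
  refine eq_starProjection_of_symmetric (fun v w => ?_) (fun w => ?_) fun w hw => ?_
  · simp only [colAsym, smul_apply, sum_apply, inner_smul_left, inner_smul_right, sum_inner,
      inner_sum, inner_slotOp_left]
    rw [map_inv₀, map_pow, map_natCast]
    congr 1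
    refine Fintype.sum_equiv (Equiv.inv _) _ _ fun s => ?_
    rw [Equiv.inv_apply, map_inv, Equiv.Perm.sign_inv, map_intCast]
  · refine mem_tensorSq_fermionSpace.2 fun s p => ?_
    exact congrArg (fun A : Op₂ d L => A w p) (slotOp_mul_colAsym s)
  · have h : ∀ s : Equiv.Perm (Fin L) × Equiv.Perm (Fin L),
        ((sign (sumCongrHom _ _ s) : ℤ) : ℂ) • slotOp d (sumCongrHom _ _ s) w = w := fun s => by
      ext p
      rw [PiLp.smul_apply, slotOp_apply, mem_tensorSq_fermionSpace.1 hw, smul_eq_mul, ← mul_assoc,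
        sign_mul_self_complex, one_mul]
    have hc : (Fintype.card (Equiv.Perm (Fin L) × Equiv.Perm (Fin L)) : ℂ) = (L ! : ℂ) ^ 2 := by
      simp [Fintype.card_perm, sq]
    simp only [colAsym, smul_apply, sum_apply]
    rw [Finset.sum_congr rfl fun s _ => h s, Finset.sum_const, Finset.card_univ,
      ← Nat.cast_smul_eq_nsmul ℂ, hc, smul_smul,
      inv_mul_cancel₀ (pow_ne_zero _ (Nat.cast_ne_zero.2 (Nat.factorial_ne_zero L))), one_smul]

theorem colAsym_mul_self : colAsym d L * colAsym d L = colAsym d L := by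
  rw [colAsym_eq_starProjection]
  exact Submodule.isIdempotentElem_starProjection _

/-! ### Idempotency of the Young symmetrizer with two columns -/

/-- Between the column antisymmetrizer and the row symmetrizer every permutation of the factors acts
as a scalar. If it sends the two factors of a row into one column, the transposition of the images
is a column permutation on the left and a row permutation on the right, so the product vanishes.
Otherwise it is the product of a column permutation and a row permutation. -/
theorem exists_colAsym_mul_slotOp_mul_pairProjProd (g : Equiv.Perm (Fin L ⊕ Fin L)) :
    ∃ e : ℂ, ∀ d, colAsym d L * slotOp d g * pairProjProd d L =
      e • (colAsym d L * pairProjProd d L) := by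
  by_cases hg : ∃ i, (g (Sum.inl i)).isLeft = (g (Sum.inr i)).isLeft
  · obtain ⟨i, hi⟩ := hg
    refine ⟨0, fun d => ?_⟩
    have hne : g (Sum.inl i) ≠ g (Sum.inr i) := fun h => by simpa using g.injective h
    obtain ⟨s, hs⟩ : ∃ s, sumCongrHom _ _ s = Equiv.swap (g (Sum.inl i)) (g (Sum.inr i)) := by
      rcases ha : g (Sum.inl i) with a | a <;> rcases hb : g (Sum.inr i) with b | b <;>
        simp only [ha, hb, Sum.isLeft_inl, Sum.isLeft_inr, reduceCtorEq] at hi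
      · exact ⟨(Equiv.swap a b, 1), Equiv.Perm.sumCongr_swap_one a b⟩
      · exact ⟨(1, Equiv.swap a b), Equiv.Perm.sumCongr_one_swap a b⟩
    have hsg : sumCongrHom _ _ s * g = g * rowSwap {i} := by
      rw [hs, rowSwap_singleton, Equiv.mul_swap_eq_swap_mul]
    have h1 := colAsym_mul_slotOp (d := d) s
    rw [hs, Equiv.Perm.sign_swap hne, ← hs] at h1
    have hcol : ∀ v p, colAsym d L (slotOp d (sumCongrHom _ _ s) v) p = -colAsym d L v p :=
      fun v p => by simpa using congrArg (fun A : Op₂ d L => A v p) h1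
    have hrow : slotOp d (sumCongrHom _ _ s) * (slotOp d g * pairProjProd d L) =
        slotOp d g * pairProjProd d L := by
      rw [← mul_assoc, ← slotOp_mul, hsg, slotOp_mul, mul_assoc, slotOp_rowSwap_mul_pairProjProd]
    ext w p
    have h2 := hcol ((slotOp d g * pairProjProd d L) w) p
    rw [← mul_apply_eq_comp (slotOp d (sumCongrHom _ _ s)), hrow] at h2
    refine (self_eq_neg.1 h2).trans ?_
    simp
  · push Not at hg
    set S : Finset (Fin L) := Finset.univ.filter fun i => (g (Sum.inl i)).isRight with hS
    obtain ⟨s, hs⟩ : g * rowSwap S ∈ (sumCongrHom (Fin L) (Fin L)).range := by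
      refine Equiv.Perm.mem_sumCongrHom_range_of_perm_mapsTo_inl ?_
      rintro _ ⟨i, rfl⟩
      rw [Set.mem_range, Equiv.Perm.mul_apply, rowSwap_inl]
      have := hg i
      by_cases hi : (g (Sum.inl i)).isRight
      · rw [if_pos (by simpa [hS] using hi)]
        rcases h : g (Sum.inr i) with a | a
        · exact ⟨a, rfl⟩
        · rcases h' : g (Sum.inl i) with b | b <;> simp [h, h'] at this hi
      · rw [if_neg (by simpa [hS] using hi)]
        rcases h : g (Sum.inl i) with a | a
        · exact ⟨a, rfl⟩
        · simp [h] at hi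
    refine ⟨((sign (sumCongrHom _ _ s) : ℤ) : ℂ), fun d => ?_⟩
    rw [← slotOp_rowSwap_mul_pairProjProd S, ← mul_assoc, mul_assoc (colAsym d L), ← slotOp_mul,
      ← hs, colAsym_mul_slotOp, smul_mul_assoc, slotOp_rowSwap_mul_pairProjProd]

/-- The product of the column antisymmetrizer and the row symmetrizer is idempotent up to a factor
that does not depend on `d`. -/
theorem exists_colAsym_mul_pairProjProd_mul_self (L : ℕ) :
    ∃ k : ℂ, ∀ d, colAsym d L * pairProjProd d L * (colAsym d L * pairProjProd d L) =
      k • (colAsym d L * pairProjProd d L) := by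
  choose e he using exists_colAsym_mul_slotOp_mul_pairProjProd (L := L)
  refine ⟨((2 : ℂ) ^ L)⁻¹ * ((L ! : ℂ) ^ 2)⁻¹ * ∑ S : Finset (Fin L),
    ∑ s : Equiv.Perm (Fin L) × Equiv.Perm (Fin L), ((sign (sumCongrHom _ _ s) : ℤ) : ℂ) *
      e (rowSwap S * sumCongrHom _ _ s), fun d => ?_⟩
  have h : pairProjProd d L * colAsym d L = (((2 : ℂ) ^ L)⁻¹ * ((L ! : ℂ) ^ 2)⁻¹) •
      ∑ S : Finset (Fin L), ∑ s : Equiv.Perm (Fin L) × Equiv.Perm (Fin L),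
        ((sign (sumCongrHom _ _ s) : ℤ) : ℂ) • slotOp d (rowSwap S * sumCongrHom _ _ s) := by
    rw [pairProjProd_eq, colAsym, smul_mul_smul_comm, Finset.sum_mul_sum]
    simp only [mul_smul_comm, slotOp_mul]
  calc colAsym d L * pairProjProd d L * (colAsym d L * pairProjProd d L)
      = colAsym d L * (pairProjProd d L * colAsym d L) * pairProjProd d L := by
        simp only [mul_assoc]
    _ = _ := by
        rw [h]
        simp only [mul_smul_comm, smul_mul_assoc, Finset.mul_sum, Finset.sum_mul, he, smul_smul,
          ← Finset.sum_smul]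

/-! ### Traces of exchange operators between antisymmetrizers -/

theorem sum_sign_eq_zero_of_not_injective {α β : Type*} [Fintype α] [DecidableEq α]
    [DecidableEq β] {x : α → β} (hx : ¬ Function.Injective x) (z : α → β) :
    ∑ σ : Equiv.Perm α, (if x ∘ σ = z then ((sign σ : ℤ) : ℂ) else 0) = 0 := by
  simp only [Function.Injective, not_forall] at hx
  obtain ⟨i, j, hij, hne⟩ := hx
  have hsw : x ∘ Equiv.swap i j = x := by
    funext k
    simp only [Function.comp_apply, Equiv.swap_apply_def]
    split_ifs with h1 h2
    · rw [h1, hij]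
    · rw [h2, hij]
    · rfl
  refine self_eq_neg.1 ?_
  rw [← Finset.sum_neg_distrib]
  refine Fintype.sum_equiv (Equiv.mulLeft (Equiv.swap i j)) _ _ fun σ => ?_
  have : x ∘ (Equiv.swap i j * σ) = x ∘ σ := by
    rw [Equiv.Perm.coe_mul, ← Function.comp_assoc, hsw]
  rw [Equiv.coe_mulLeft, this, Equiv.Perm.sign_mul, Equiv.Perm.sign_swap hne]
  split_ifs <;> simp

theorem sum_sign_eq_of_injective {α β : Type*} [Fintype α] [DecidableEq α]
    [DecidableEq β] {x : α → β} (hx : Function.Injective x) (σ : Equiv.Perm α) :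
    ∑ τ : Equiv.Perm α, (if x ∘ τ = x ∘ σ then ((sign τ : ℤ) : ℂ) else 0) =
      ((sign σ : ℤ) : ℂ) := by
  have : ∀ τ : Equiv.Perm α, x ∘ τ = x ∘ σ ↔ τ = σ := fun τ =>
    ⟨fun h => Equiv.ext fun a => hx (congrFun h a), fun h => by rw [h]⟩
  simp [this]

/-- If `y` is injective and `x`, `y` have the same image of `S`, one permutation, supported on `S`,
relates both of them to the pair obtained by exchanging `x` and `y` on `S`. -/
theorem exists_perm_piecewise {α β : Type*} [Fintype α] [DecidableEq α] [DecidableEq β]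
    {x y : α → β} (hy : Function.Injective y) {S : Finset α}
    (h : S.image x = S.image y) : ∃ σ : Equiv.Perm α,
      x ∘ σ = S.piecewise y x ∧ y ∘ (σ⁻¹ : Equiv.Perm α) = S.piecewise x y := by
  have hex : ∀ k ∈ S, ∃ j ∈ S, x j = y k := fun k hk =>
    Finset.mem_image.1 (h ▸ Finset.mem_image_of_mem y hk)
  choose f hf hfx using hex
  let F : α → α := fun k => if hk : k ∈ S then f k hk else k
  have hFS : ∀ k (hk : k ∈ S), F k = f k hk := fun k hk => dif_pos hk
  have hFN : ∀ k, k ∉ S → F k = k := fun k hk => dif_neg hk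
  have hinj : Function.Injective F := by
    intro a b hab
    by_cases ha : a ∈ S <;> by_cases hb : b ∈ S
    · rw [hFS a ha, hFS b hb] at hab
      exact hy (by rw [← hfx a ha, ← hfx b hb, hab])
    · rw [hFS a ha, hFN b hb] at hab
      exact absurd (hab ▸ hf a ha) hb
    · rw [hFN a ha, hFS b hb] at hab
      exact absurd (hab ▸ hf b hb) ha
    · rwa [hFN a ha, hFN b hb] at hab
  let σ : Equiv.Perm α := Equiv.ofBijective F (Finite.injective_iff_bijective.1 hinj)
  have hσ : x ∘ σ = S.piecewise y x := by
    funext k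
    change x (F k) = _
    by_cases hk : k ∈ S
    · rw [hFS k hk, hfx k hk, Finset.piecewise_eq_of_mem _ _ _ hk]
    · rw [hFN k hk, Finset.piecewise_eq_of_notMem _ _ _ hk]
  refine ⟨σ, hσ, ?_⟩
  have hmem : ∀ k, σ k ∈ S ↔ k ∈ S := fun k => by
    change F k ∈ S ↔ k ∈ S
    by_cases hk : k ∈ S
    · simp [hFS k hk, hf k hk, hk]
    · simp [hFN k hk, hk]
  funext k
  obtain ⟨j, rfl⟩ := σ.surjective k
  rw [Function.comp_apply, Equiv.Perm.inv_def, Equiv.symm_apply_apply]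
  by_cases hj : j ∈ S
  · rw [Finset.piecewise_eq_of_mem _ _ _ ((hmem j).2 hj)]
    have := congrFun hσ j
    rw [Function.comp_apply, Finset.piecewise_eq_of_mem _ _ _ hj] at this
    exact this.symm
  · rw [Finset.piecewise_eq_of_notMem _ _ _ (mt (hmem j).1 hj)]
    change y j = y (F j)
    rw [hFN j hj]

theorem image_eq_of_comp_eq_piecewise {α β : Type*} [Fintype α] [DecidableEq α] [DecidableEq β]
    {x y : α → β} (hx : Function.Injective x) (hy : Function.Injective y) {S : Finset α}
    {σ : Equiv.Perm α} (hσ : x ∘ σ = S.piecewise y x) : S.image x = S.image y := by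
  symm
  refine Finset.eq_of_subset_of_card_le (fun b hb => ?_) ?_
  · obtain ⟨k, hk, rfl⟩ := Finset.mem_image.1 hb
    have h1 := congrFun hσ k
    rw [Function.comp_apply, Finset.piecewise_eq_of_mem _ _ _ hk] at h1
    rw [← h1]
    refine Finset.mem_image_of_mem x ?_
    -- `σ` fixes the complement of `S`, so it maps `S` into itself.
    by_contra hn
    have h2 := congrFun hσ (σ k)
    rw [Function.comp_apply, Finset.piecewise_eq_of_notMem _ _ _ hn] at h2
    have h3 := σ.injective (hx h2)
    exact hn (h3.symm ▸ hk)
  · rw [Finset.card_image_of_injective _ hx, Finset.card_image_of_injective _ hy]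

theorem sum_sign_mul_sum_sign {x y : Idx d L} (S : Finset (Fin L)) :
    (∑ σ : Equiv.Perm (Fin L), (if x ∘ σ = S.piecewise y x then ((sign σ : ℤ) : ℂ) else 0)) *
      (∑ τ : Equiv.Perm (Fin L), (if y ∘ τ = S.piecewise x y then ((sign τ : ℤ) : ℂ) else 0)) =
    if Function.Injective x ∧ Function.Injective y ∧ S.image x = S.image y then 1 else 0 := by
  by_cases hx : Function.Injective x
  swap
  · rw [sum_sign_eq_zero_of_not_injective hx, zero_mul, if_neg fun h => hx h.1]
  by_cases hy : Function.Injective y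
  swap
  · rw [sum_sign_eq_zero_of_not_injective hy, mul_zero, if_neg fun h => hy h.2.1]
  by_cases h : S.image x = S.image y
  · obtain ⟨σ, h1, h2⟩ := exists_perm_piecewise hy h
    rw [← h1, ← h2, sum_sign_eq_of_injective hx, sum_sign_eq_of_injective hy, Equiv.Perm.sign_inv,
      sign_mul_self_complex, if_pos ⟨hx, hy, h⟩]
  · rw [if_neg fun h' => h h'.2.2, Finset.sum_eq_zero, zero_mul]
    exact fun σ _ => if_neg fun hσ => h (image_eq_of_comp_eq_piecewise hx hy hσ)

theorem card_filter_injective :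
    (Finset.univ.filter fun x : Idx d L => Function.Injective x).card = d.descFactorial L := by
  rw [← Fintype.card_subtype, Fintype.card_congr (Equiv.subtypeInjectiveEquivEmbedding _ _),
    Fintype.card_embedding_eq, Fintype.card_fin, Fintype.card_fin]

/-- The image of `S` under a uniformly random injection is a uniformly random set of size `#S`. -/
theorem choose_mul_card_filter_image_eq (S : Finset (Fin L)) {B : Finset (Fin d)}
    (hB : B.card = S.card) :
    d.choose S.card * (Finset.univ.filter fun y : Idx d L =>
      Function.Injective y ∧ S.image y = B).card = d.descFactorial L := by
  have key : ∀ C ∈ Finset.powersetCard S.card (Finset.univ : Finset (Fin d)),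
      ((Finset.univ.filter fun y : Idx d L => Function.Injective y).filter
        fun y => S.image y = C).card =
      (Finset.univ.filter fun y : Idx d L => Function.Injective y ∧ S.image y = B).card := by
    intro C hC
    rw [Finset.mem_powersetCard] at hC
    let e : {a // a ∈ C} ≃ {a // a ∈ B} := Finset.equivOfCardEq (hC.2.trans hB.symm)
    let π : Equiv.Perm (Fin d) := e.extendSubtype
    have hπ : C.image π = B := by
      refine Finset.eq_of_subset_of_card_le (fun b hb => ?_) ?_
      · obtain ⟨c, hc, rfl⟩ := Finset.mem_image.1 hb
        exact e.extendSubtype_mem c hc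
      · rw [Finset.card_image_of_injective _ π.injective, hB, hC.2]
    rw [Finset.filter_filter]
    refine Finset.card_equiv (Equiv.arrowCongr (Equiv.refl _) π) fun y => ?_
    simp only [Finset.mem_filter, Finset.mem_univ, true_and]
    change _ ↔ Function.Injective (π ∘ y) ∧ S.image (π ∘ y) = B
    rw [π.injective.of_comp_iff, ← Finset.image_image, ← hπ,
      (Finset.image_injective π.injective).eq_iff]
  rw [← card_filter_injective (d := d) (L := L),
    Finset.card_eq_sum_card_fiberwise (f := fun y : Idx d L => S.image y)
      (s := Finset.univ.filter fun y : Idx d L => Function.Injective y)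
      (t := Finset.powersetCard S.card Finset.univ), Finset.sum_congr rfl key, Finset.sum_const,
    Finset.card_powersetCard, Finset.card_univ, Fintype.card_fin, smul_eq_mul]
  intro y hy
  rw [Finset.mem_coe, Finset.mem_powersetCard]
  exact ⟨Finset.subset_univ _, Finset.card_image_of_injective _ (Finset.mem_filter.1 hy).2⟩

theorem choose_mul_sum_injective (S : Finset (Fin L)) :
    (d.choose S.card : ℂ) * ∑ p : Idx d L × Idx d L,
      (if Function.Injective p.1 ∧ Function.Injective p.2 ∧ S.image p.1 = S.image p.2
        then (1 : ℂ) else 0) = (d.descFactorial L : ℂ) ^ 2 := by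
  have h : ∀ x : Idx d L, (d.choose S.card : ℂ) * ∑ y : Idx d L,
      (if Function.Injective x ∧ Function.Injective y ∧ S.image x = S.image y
        then (1 : ℂ) else 0) = if Function.Injective x then (d.descFactorial L : ℂ) else 0 := by
    intro x
    by_cases hx : Function.Injective x
    · rw [if_pos hx, ← choose_mul_card_filter_image_eq S (Finset.card_image_of_injective S hx),
        Finset.card_filter]
      push_cast
      simp only [hx, true_and, eq_comm]
    · simp [hx]
  rw [Fintype.sum_prod_type, Finset.mul_sum, Finset.sum_congr rfl fun x _ => h x,
    ← Finset.sum_filter, Finset.sum_const, card_filter_injective, nsmul_eq_mul, sq]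

/-- `tr (P_⋀ · (exchange of the pairs in S)) = (dim ⋀^L)² / binom(d, #S)`. -/
theorem trace_colAsym_mul_slotOp (hL : L ≤ d) (S : Finset (Fin L)) :
    LinearMap.trace ℂ _ (colAsym d L * slotOp d (rowSwap S)).toLinearMap =
      (d.choose L : ℂ) ^ 2 / d.choose S.card := by
  have hfix : ∀ (s : Equiv.Perm (Fin L) × Equiv.Perm (Fin L)) (p : Idx d L × Idx d L),
      slotPerm (sumCongrHom _ _ s * rowSwap S) p = p ↔
        p.1 ∘ s.1 = S.piecewise p.2 p.1 ∧ p.2 ∘ s.2 = S.piecewise p.1 p.2 := by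
    intro s p
    rw [← slotPerm_slotPerm]
    have : slotPerm (rowSwap S) (slotPerm (sumCongrHom _ _ s) p) = p ↔
        slotPerm (sumCongrHom _ _ s) p = slotPerm (rowSwap S) p := by
      constructor
      · intro h
        conv_rhs => rw [← h]
        rw [slotPerm_slotPerm, rowSwap_mul, symmDiff_self, Finset.bot_eq_empty, rowSwap_empty,
          slotPerm_one]
      · intro h
        rw [h, slotPerm_slotPerm, rowSwap_mul, symmDiff_self, Finset.bot_eq_empty, rowSwap_empty,
          slotPerm_one]
    rw [this, slotPerm_rowSwap, Equiv.Perm.sumCongrHom_apply, slotPerm_sumCongr, Prod.mk.injEq]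
  have htr : LinearMap.trace ℂ _ (colAsym d L * slotOp d (rowSwap S)).toLinearMap =
      ((L ! : ℂ) ^ 2)⁻¹ * ∑ s : Equiv.Perm (Fin L) × Equiv.Perm (Fin L),
        ((sign (sumCongrHom _ _ s) : ℤ) : ℂ) *
          LinearMap.trace ℂ _ (slotOp d (sumCongrHom _ _ s * rowSwap S)).toLinearMap := by
    rw [colAsym, smul_mul_assoc, Finset.sum_mul]
    simp only [smul_mul_assoc, ← slotOp_mul]
    simp [ContinuousLinearMap.toLinearMap_smul, ContinuousLinearMap.toLinearMap_sum]
  have hsum : ∑ s : Equiv.Perm (Fin L) × Equiv.Perm (Fin L),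
        ((sign (sumCongrHom _ _ s) : ℤ) : ℂ) *
          LinearMap.trace ℂ _ (slotOp d (sumCongrHom _ _ s * rowSwap S)).toLinearMap =
      ∑ p : Idx d L × Idx d L,
        if Function.Injective p.1 ∧ Function.Injective p.2 ∧ S.image p.1 = S.image p.2
          then (1 : ℂ) else 0 := by
    simp only [slotOp, trace_permOp, hfix, Finset.card_filter, Nat.cast_sum, Finset.mul_sum]
    rw [Finset.sum_comm]
    refine Finset.sum_congr rfl fun p _ => ?_
    rw [← sum_sign_mul_sum_sign, Finset.sum_mul_sum, Fintype.sum_prod_type]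
    refine Finset.sum_congr rfl fun σ _ => Finset.sum_congr rfl fun τ _ => ?_
    rw [Equiv.Perm.sumCongrHom_apply, Equiv.Perm.sign_sumCongr]
    split_ifs <;> simp_all
  have hC : (d.choose S.card : ℂ) ≠ 0 := by
    have : S.card ≤ d := (Finset.card_le_univ S).trans (by simpa using hL)
    exact_mod_cast (Nat.choose_pos this).ne'
  have hL0 : (L ! : ℂ) ≠ 0 := Nat.cast_ne_zero.2 (Nat.factorial_ne_zero L)
  have h := choose_mul_sum_injective (d := d) S
  rw [Nat.descFactorial_eq_factorial_mul_choose] at h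
  rw [htr, hsum, eq_div_iff hC, mul_assoc, mul_comm _ (d.choose S.card : ℂ), h]
  push_cast
  field_simp

theorem sum_choose_sub (d L : ℕ) (h : L ≤ d) :
    ∑ m ∈ Finset.range (L + 1), (d - m).choose (L - m) = (d + 1).choose L := by
  induction L generalizing d with
  | zero => simp
  | succ L ih =>
    obtain ⟨d, rfl⟩ : ∃ e, d = e + 1 := ⟨d - 1, by omega⟩
    rw [Finset.sum_range_succ']
    simp only [Nat.add_sub_add_right, Nat.sub_zero]
    rw [ih d (by omega), Nat.choose_succ_succ (d + 1) L]

theorem trace_colAsym_mul_pairProjProd (hL : L ≤ d) :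
    LinearMap.trace ℂ _ (colAsym d L * pairProjProd d L).toLinearMap =
      ((2 : ℂ) ^ L)⁻¹ * (d.choose L * (d + 1).choose L) := by
  have h1 : LinearMap.trace ℂ _ (colAsym d L * pairProjProd d L).toLinearMap =
      ((2 : ℂ) ^ L)⁻¹ * ∑ S : Finset (Fin L),
        LinearMap.trace ℂ _ (colAsym d L * slotOp d (rowSwap S)).toLinearMap := by
    rw [pairProjProd_eq, mul_smul_comm, Finset.mul_sum]
    simp [ContinuousLinearMap.toLinearMap_smul, ContinuousLinearMap.toLinearMap_sum]
  rw [h1, Finset.sum_congr rfl fun S _ => trace_colAsym_mul_slotOp hL S, ← Finset.powerset_univ,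
    Finset.sum_powerset_apply_card fun m => (d.choose L : ℂ) ^ 2 / d.choose m, Finset.card_univ,
    Fintype.card_fin, ← sum_choose_sub d L hL]
  push_cast
  rw [Finset.mul_sum (Finset.range (L + 1)) _ (d.choose L : ℂ)]
  congr 1
  refine Finset.sum_congr rfl fun m hm => ?_
  have hm' : m ≤ L := by simpa [Nat.lt_succ_iff] using hm
  have hC : (d.choose m : ℂ) ≠ 0 := by exact_mod_cast (Nat.choose_pos (hm'.trans hL)).ne'
  have h2 : (d.choose L : ℂ) * L.choose m = d.choose m * (d - m).choose (L - m) := by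
    exact_mod_cast Nat.choose_mul hm'
  rw [nsmul_eq_mul]
  field_simp
  linear_combination (d.choose L : ℂ) * h2

end Slater

/-! ### Slater determinants -/

section SlaterRow

variable {d L : ℕ}

theorem finrank_fermionSpace (hL : L ≤ d) :
    Module.finrank ℂ (fermionSpace d L) = d.choose L := by
  have h1 := trace_colAsym_mul_slotOp hL ∅
  rw [rowSwap_empty, slotOp_one, mul_one, colAsym_eq_starProjection] at h1
  have h2 : LinearMap.IsProj (tensorSq (fermionSpace d L))
      (tensorSq (fermionSpace d L)).starProjection.toLinearMap :=
    ⟨fun w => Submodule.starProjection_apply_mem _ w,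
      fun w hw => Submodule.starProjection_eq_self_iff.2 hw⟩
  rw [h2.trace, finrank_tensorSq, Finset.card_empty, Nat.choose_zero_right, Nat.cast_one,
    div_one] at h1
  exact Nat.pow_left_injective two_ne_zero (by exact_mod_cast h1)

/-- For `d = L` the space `⋀^L ⊗ ⋀^L` is a line, so the compression of the row symmetrizer to it is
a scalar, namely its trace. -/
theorem colAsym_mul_pairProjProd_mul_colAsym_self (L : ℕ) :
    colAsym L L * pairProjProd L L * colAsym L L =
      (((2 : ℂ) ^ L)⁻¹ * (L + 1)) • colAsym L L := by
  have hdim : Module.finrank ℂ (tensorSq (fermionSpace L L)) = 1 := by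
    rw [finrank_tensorSq, finrank_fermionSpace le_rfl, Nat.choose_self, one_pow]
  obtain ⟨v, hv0, hv⟩ := finrank_eq_one_iff'.1 hdim
  have hmem : ∀ w, colAsym L L w ∈ tensorSq (fermionSpace L L) := fun w => by
    rw [colAsym_eq_starProjection]; exact Submodule.starProjection_apply_mem _ w
  obtain ⟨c, hc⟩ := hv ⟨colAsym L L (pairProjProd L L v), hmem _⟩
  have hc' : c • (v : EuclideanSpace ℂ (Idx L L × Idx L L)) =
    colAsym L L (pairProjProd L L v) := congrArg Subtype.val hc
  have hmain : colAsym L L * pairProjProd L L * colAsym L L = c • colAsym L L := by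
    ext1 w
    obtain ⟨a, ha⟩ := hv ⟨colAsym L L w, hmem w⟩
    have ha' : a • (v : EuclideanSpace ℂ (Idx L L × Idx L L)) = colAsym L L w :=
      congrArg Subtype.val ha
    simp only [mul_apply_eq_comp, smul_apply]
    rw [← ha', map_smul, map_smul, ← hc', smul_comm]
  have htr := trace_colAsym_mul_pairProjProd (le_refl L)
  have h1 : LinearMap.trace ℂ _ (colAsym L L * pairProjProd L L * colAsym L L).toLinearMap =
      LinearMap.trace ℂ _ (colAsym L L * pairProjProd L L).toLinearMap := by
    rw [ContinuousLinearMap.toLinearMap_mul, LinearMap.trace_mul_comm,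
      ← ContinuousLinearMap.toLinearMap_mul, ← mul_assoc, colAsym_mul_self]
  have h2 := trace_colAsym_mul_slotOp (le_refl L) ∅
  rw [rowSwap_empty, slotOp_one, mul_one] at h2
  rw [hmain, htr, ContinuousLinearMap.toLinearMap_smul, map_smul, h2] at h1
  have : c = ((2 : ℂ) ^ L)⁻¹ * (L + 1) := by simpa using h1
  rw [hmain, this]

/-- The proportionality factor does not depend on `d`, and for `d = L` it is a trace. -/
theorem colAsym_mul_pairProjProd_mul_self :
    colAsym d L * pairProjProd d L * (colAsym d L * pairProjProd d L) =
      (((2 : ℂ) ^ L)⁻¹ * (L + 1)) • (colAsym d L * pairProjProd d L) := by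
  obtain ⟨k, hk⟩ := exists_colAsym_mul_pairProjProd_mul_self L
  have h := hk L
  rw [← mul_assoc, colAsym_mul_pairProjProd_mul_colAsym_self, smul_mul_assoc] at h
  have ht := congrArg (fun A : Op₂ L L => LinearMap.trace ℂ _ A.toLinearMap) h
  simp only [ContinuousLinearMap.toLinearMap_smul, map_smul,
    trace_colAsym_mul_pairProjProd le_rfl, smul_eq_mul] at ht
  have hne : ((2 : ℂ) ^ L)⁻¹ * (L.choose L * (L + 1).choose L) ≠ 0 := by
    have : (L : ℂ) + 1 ≠ 0 := Nat.cast_add_one_ne_zero L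
    simpa using this
  rw [hk d, mul_right_cancel₀ hne ht]

variable (d L) in
/-- `2^L / (L + 1) • P_⋀ P⁺_{11'} ⋯ P⁺_{LL'} P_⋀`, the Young projector of the shape with `L` rows of
length two. -/
def slaterProj : Op₂ d L :=
  ((2 : ℂ) ^ L / ((L : ℂ) + 1)) • (colAsym d L * pairProjProd d L * colAsym d L)

theorem slaterProj_mul_self : slaterProj d L * slaterProj d L = slaterProj d L := by
  have h : colAsym d L * pairProjProd d L * colAsym d L *
      (colAsym d L * pairProjProd d L * colAsym d L) =
      (((2 : ℂ) ^ L)⁻¹ * (L + 1)) • (colAsym d L * pairProjProd d L * colAsym d L) := by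
    rw [← smul_mul_assoc, ← colAsym_mul_pairProjProd_mul_self]
    simp only [← mul_assoc]
    rw [mul_assoc (colAsym d L * pairProjProd d L) (colAsym d L) (colAsym d L), colAsym_mul_self]
  have h0 : (L : ℂ) + 1 ≠ 0 := Nat.cast_add_one_ne_zero L
  rw [slaterProj, smul_mul_smul_comm, h, smul_smul]
  congr 1
  field_simp

theorem trace_slaterProj (hL : L ≤ d) : LinearMap.trace ℂ _ (slaterProj d L).toLinearMap =
    d.choose L * (d + 1).choose L / (L + 1) := by
  have h1 : LinearMap.trace ℂ _ (colAsym d L * pairProjProd d L * colAsym d L).toLinearMap =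
      LinearMap.trace ℂ _ (colAsym d L * pairProjProd d L).toLinearMap := by
    rw [ContinuousLinearMap.toLinearMap_mul, LinearMap.trace_mul_comm,
      ← ContinuousLinearMap.toLinearMap_mul, ← mul_assoc, colAsym_mul_self]
  rw [slaterProj, ContinuousLinearMap.toLinearMap_smul, map_smul, h1,
    trace_colAsym_mul_pairProjProd hL, smul_eq_mul]
  field_simp

theorem slaterProj_eq_compress : slaterProj d L = compress (fermionSpace d L)
    (((2 : ℂ) ^ L / ((L : ℂ) + 1)) • pairProjProd d L) := by
  rw [slaterProj, compress, ← colAsym_eq_starProjection, mul_smul_comm, smul_mul_assoc]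

theorem slaterA_eq :
    slaterA d L = (symSq (fermionSpace d L)).starProjection - slaterProj d L := by
  rw [slaterA, compress_sub, compress_starProjection_symSq, slaterProj_eq_compress]
  congr 1
  have h1 : asymProj₁ d L * (tensorSq (fermionSpace d L)).starProjection =
      (tensorSq (fermionSpace d L)).starProjection :=
    starProjection_mul_of_le fun w hw => by
      simp only [Submodule.mem_iInf, mem_invariantUnder]
      exact fun σ p => by
        simpa [slotPerm_sumCongr] using mem_tensorSq_fermionSpace.1 hw (σ, 1) p
  have h2 : asymProj₂ d L * (tensorSq (fermionSpace d L)).starProjection =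
      (tensorSq (fermionSpace d L)).starProjection :=
    starProjection_mul_of_le fun w hw => by
      simp only [Submodule.mem_iInf, mem_invariantUnder]
      exact fun τ p => by
        simpa [slotPerm_sumCongr] using mem_tensorSq_fermionSpace.1 hw (1, τ) p
  simp only [compress, mul_assoc, smul_mul_assoc, mul_smul_comm, h1, h2]

theorem tableRow_slater (d L : ℕ) (hL : L ≤ d) :
    TableRow (fermionSpace d L) (slaterA d L) (d.choose L)
      (2 * (d.choose L : ℝ) / ((d.choose L : ℝ) + 1) *
        (((d : ℝ) + 1) / (((L : ℝ) + 1) * ((d : ℝ) + 1 - (L : ℝ))))) := by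
  have hid : ∀ w, slaterProj d L (slaterProj d L w) = slaterProj d L w := fun w =>
    congrArg (fun A : Op₂ d L => A w) slaterProj_mul_self
  refine tableRow_of_fixed (F := LinearMap.range (slaterProj d L).toLinearMap) slaterA_eq ?_ ?_
    (fun w => ⟨?_, fun h => ⟨w, h⟩⟩) (finrank_fermionSpace hL) (Nat.choose_pos hL) ?_
  · rw [slaterProj_eq_compress]
    refine inner_compress_left fun v w => ?_
    rw [smul_apply, smul_apply, inner_smul_left, inner_smul_right, inner_pairProjProd_left]
    rw [map_div₀, map_pow, map_ofNat, map_add, map_natCast, map_one]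
  · rw [slaterProj_eq_compress]
    exact compress_mem_symSq fun w =>
      Submodule.smul_mem _ _ (pairProjProd_mem_invariantUnder_swap w)
  · rintro ⟨v, rfl⟩
    exact hid v
  · have hproj : LinearMap.IsProj (LinearMap.range (slaterProj d L).toLinearMap)
        (slaterProj d L).toLinearMap :=
      ⟨fun w => ⟨w, rfl⟩, fun w hw => by obtain ⟨v, rfl⟩ := hw; exact hid v⟩
    have h1 := hproj.trace
    rw [trace_slaterProj hL] at h1
    have h2 : (Module.finrank ℂ (LinearMap.range (slaterProj d L).toLinearMap) : ℝ) =
        d.choose L * (d + 1).choose L / (L + 1) := by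
      have : ((Module.finrank ℂ (LinearMap.range (slaterProj d L).toLinearMap) : ℝ) : ℂ) =
          ((d.choose L * (d + 1).choose L / (L + 1) : ℝ) : ℂ) := by
        push_cast
        exact h1.symm
      exact_mod_cast this
    have h3 : (d.choose L : ℝ) * (d + 1) = (d + 1).choose L * (d + 1 - L) := by
      have := Nat.choose_mul_succ_eq d L
      have h4 : ((d + 1 - L : ℕ) : ℝ) = d + 1 - L := by
        rw [Nat.cast_sub (by omega)]; push_cast; ring
      rw [← h4]
      exact_mod_cast this
    have h5 : (0 : ℝ) < d + 1 - L := by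
      have : (L : ℝ) ≤ d := by exact_mod_cast hL
      linarith
    rw [h2]
    have h6 : (0 : ℝ) < (d.choose L : ℝ) + 1 := by positivity
    have h7 : (0 : ℝ) < (L : ℝ) + 1 := by positivity
    field_simp
    linear_combination -(d.choose L : ℝ) * h3

end SlaterRow

/-! ### The operator `Λ` in the occupation number basis -/

section Fock

variable {d : ℕ}

theorem prod_symmDiff_of_mul_self {α : Type*} [DecidableEq α] {f : α → ℂ}
    (hf : ∀ a, f a * f a = 1) (S T : Finset α) :
    ∏ a ∈ S ∆ T, f a = (∏ a ∈ S, f a) * ∏ a ∈ T, f a := by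
  have hsd : S ∆ T = S \ T ∪ T \ S := rfl
  have hdisj : Disjoint (S \ T) (T \ S) := disjoint_sdiff_sdiff
  have hI : (∏ a ∈ S ∩ T, f a) * ∏ a ∈ S ∩ T, f a = 1 := by
    rw [← Finset.prod_mul_distrib]
    exact Finset.prod_eq_one fun a _ => hf a
  rw [hsd, Finset.prod_union hdisj, ← Finset.prod_inter_mul_prod_sdiff S T f,
    ← Finset.prod_inter_mul_prod_sdiff T S f, Finset.inter_comm T S]
  linear_combination -(∏ a ∈ S \ T, f a) * (∏ a ∈ T \ S, f a) * hI

/-- The Jordan–Wigner sign `(-1)^{#{j ∈ S, j < k}}`. -/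
def jwSign (S : Finset (Fin d)) (k : Fin d) : ℂ := ∏ j ∈ S, if j < k then -1 else 1

theorem jwSign_eq_pow (S : Finset (Fin d)) (k : Fin d) :
    jwSign S k = (-1) ^ (S.filter fun j => j < k).card := by
  rw [jwSign, Finset.prod_ite, Finset.prod_const, Finset.prod_const_one, mul_one]

theorem jwSign_symmDiff (S T : Finset (Fin d)) (k : Fin d) :
    jwSign (S ∆ T) k = jwSign S k * jwSign T k :=
  prod_symmDiff_of_mul_self (fun a => by split_ifs <;> norm_num) S T

theorem jwSign_mul_self (S : Finset (Fin d)) (k : Fin d) : jwSign S k * jwSign S k = 1 := by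
  rw [← jwSign_symmDiff, symmDiff_self]
  exact Finset.prod_empty

theorem jwSign_symmDiff_singleton_self (S : Finset (Fin d)) (k : Fin d) :
    jwSign (S ∆ {k}) k = jwSign S k := by
  rw [jwSign_symmDiff]
  simp [jwSign]

theorem ann_apply (k : Fin d) (S T : Finset (Fin d)) :
    ann d k S T = if T = S ∆ {k} then (if k ∈ S then 0 else jwSign S k) else 0 := by
  rw [ann, Matrix.of_apply, ← jwSign_eq_pow]
  by_cases hk : k ∈ S
  · simp [hk]
  · have : insert k S = S ∆ {k} := by
      ext j
      simp only [Finset.mem_insert, Finset.mem_symmDiff, Finset.mem_singleton]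
      grind
    simp [hk, this]

theorem ann_conjTranspose_apply (k : Fin d) (S T : Finset (Fin d)) :
    (ann d k).conjTranspose S T = if T = S ∆ {k} then (if k ∈ S then jwSign S k else 0) else 0 := by
  have hiff : S = T ∆ {k} ↔ T = S ∆ {k} := by
    constructor <;> rintro rfl <;> rw [symmDiff_symmDiff_cancel_right]
  rw [Matrix.conjTranspose_apply, ann_apply]
  simp only [hiff]
  by_cases h : T = S ∆ {k}
  · subst h
    rw [jwSign_symmDiff_singleton_self]
    by_cases hk : k ∈ S
    · simp [hk, Finset.mem_symmDiff, jwSign_eq_pow]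
    · simp [hk, Finset.mem_symmDiff]
  · simp [h]

/-- Each Majorana operator flips the occupation of one mode, with a phase. -/
theorem majorana_apply (k : Fin d × Fin 2) (S T : Finset (Fin d)) :
    majorana d k S T = if T = S ∆ {k.1} then
      (if k.2 = 0 then 1 else if k.1 ∈ S then -Complex.I else Complex.I) * jwSign S k.1 else 0 := by
  rw [majorana]
  by_cases hb : k.2 = 0
  · rw [if_pos hb, Matrix.add_apply, ann_apply, ann_conjTranspose_apply]
    by_cases h : T = S ∆ {k.1} <;> by_cases hk : k.1 ∈ S <;> simp [h, hk, hb]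
  · rw [if_neg hb, Matrix.smul_apply, Matrix.sub_apply, ann_apply, ann_conjTranspose_apply]
    by_cases h : T = S ∆ {k.1} <;> by_cases hk : k.1 ∈ S <;> simp [h, hk, hb]

variable (d) in
/-- `Λ` as an operator. -/
def lambdaOp : EuclideanSpace ℂ (Finset (Fin d) × Finset (Fin d)) →ₗ[ℂ]
    EuclideanSpace ℂ (Finset (Fin d) × Finset (Fin d)) :=
  Matrix.toEuclideanLin (majoranaLambda d)

/-- `Λ` moves one particle between the two copies, in a mode that is occupied in exactly one of
them, with a sign that depends on the symmetric difference of the occupations only. -/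
theorem lambdaOp_apply (w : EuclideanSpace ℂ (Finset (Fin d) × Finset (Fin d)))
    (S T : Finset (Fin d)) : lambdaOp d w (S, T) =
      ∑ k ∈ S ∆ T, 2 * jwSign (S ∆ T) k * w (S ∆ {k}, T ∆ {k}) := by
  have h : ∀ k : Fin d, ∑ b : Fin 2, ∑ q : Finset (Fin d) × Finset (Fin d),
      majorana d (k, b) S q.1 * majorana d (k, b) T q.2 * w q =
      if k ∈ S ∆ T then 2 * jwSign (S ∆ T) k * w (S ∆ {k}, T ∆ {k}) else 0 := by
    intro k
    have hq : ∀ b : Fin 2, ∑ q : Finset (Fin d) × Finset (Fin d),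
        majorana d (k, b) S q.1 * majorana d (k, b) T q.2 * w q =
        majorana d (k, b) S (S ∆ {k}) * majorana d (k, b) T (T ∆ {k}) *
          w (S ∆ {k}, T ∆ {k}) := by
      intro b
      refine Finset.sum_eq_single_of_mem (S ∆ {k}, T ∆ {k}) (Finset.mem_univ _) fun q _ hq => ?_
      by_cases h1 : q.1 = S ∆ {k}
      · have h2 : q.2 ≠ T ∆ {k} := fun h2 => hq (Prod.ext h1 h2)
        rw [majorana_apply (k, b) T, if_neg h2, mul_zero, zero_mul]
      · rw [majorana_apply (k, b) S, if_neg h1, zero_mul, zero_mul]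
    rw [Fin.sum_univ_two, hq, hq]
    clear hq
    simp only [majorana_apply, jwSign_symmDiff, Finset.mem_symmDiff]
    have hI := Complex.I_mul_I
    by_cases hS : k ∈ S <;> by_cases hT : k ∈ T <;> simp [hS, hT] <;> grind
  have h0 : lambdaOp d w (S, T) = ∑ q : Finset (Fin d) × Finset (Fin d),
      majoranaLambda d (S, T) q * w q := rfl
  have hk : ∀ q, majoranaLambda d (S, T) q =
      ∑ k, majorana d k S q.1 * majorana d k T q.2 := fun q => by
    rw [majoranaLambda, Matrix.sum_apply]
    rfl
  simp only [h0, hk, Finset.sum_mul]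
  rw [Finset.sum_comm, Fintype.sum_prod_type, Finset.sum_congr rfl fun k _ => h k,
    Finset.sum_ite_mem, Finset.univ_inter]

/-! ### Diagonalization of `Λ` -/

/-- The sign `1` for `k ∈ A`, and `-1` otherwise. -/
def occSign (A : Finset (Fin d)) (k : Fin d) : ℂ := if k ∈ A then 1 else -1

theorem occSign_of_mem {A : Finset (Fin d)} {k : Fin d} (h : k ∈ A) : occSign A k = 1 := if_pos h

theorem occSign_of_notMem {A : Finset (Fin d)} {k : Fin d} (h : k ∉ A) : occSign A k = -1 :=
  if_neg h

theorem occSign_mul_self (A : Finset (Fin d)) (k : Fin d) : occSign A k * occSign A k = 1 := by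
  rw [occSign]; split_ifs <;> norm_num

/-- The coordinates of the eigenvectors of `Λ`: the eigenvector labelled `(A, A ∆ U)` is supported
on the pairs `(S, S ∆ U)`, where it equals `eigSign U A S`. As a function of `S` this is a character
of the group of sets. -/
def eigSign (U A S : Finset (Fin d)) : ℂ := ∏ k ∈ S, jwSign U k * occSign A k

theorem eigFactor_mul_self (U A : Finset (Fin d)) (k : Fin d) :
    jwSign U k * occSign A k * (jwSign U k * occSign A k) = 1 := by
  rw [mul_mul_mul_comm, jwSign_mul_self, occSign_mul_self, one_mul]

theorem eigSign_symmDiff (U A S T : Finset (Fin d)) :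
    eigSign U A (S ∆ T) = eigSign U A S * eigSign U A T :=
  prod_symmDiff_of_mul_self (eigFactor_mul_self U A) S T

theorem sum_eigSign_mul_eigSign (U A A' : Finset (Fin d)) :
    ∑ S, eigSign U A S * eigSign U A' S = if A = A' then 2 ^ d else 0 := by
  have h1 : ∀ S, eigSign U A S * eigSign U A' S = ∏ k ∈ S, occSign A k * occSign A' k := by
    intro S
    rw [eigSign, eigSign, ← Finset.prod_mul_distrib]
    refine Finset.prod_congr rfl fun k _ => ?_
    rw [mul_mul_mul_comm, jwSign_mul_self, one_mul]
  rw [Finset.sum_congr rfl fun S _ => h1 S, ← Finset.powerset_univ, ← Finset.prod_one_add]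
  split_ifs with h
  · subst h
    rw [Finset.prod_congr rfl fun k _ => by rw [occSign_mul_self, one_add_one_eq_two]]
    simp
  · have : ∃ k, ¬ (k ∈ A ↔ k ∈ A') := by
      by_contra! hc
      exact h (Finset.ext hc)
    obtain ⟨k, hk⟩ := this
    refine Finset.prod_eq_zero (Finset.mem_univ k) ?_
    by_cases hA : k ∈ A <;> by_cases hA' : k ∈ A' <;> simp_all [occSign]

variable (d) in
/-- The change of basis to the eigenvectors of `Λ`. -/
def eigBasisMap : EuclideanSpace ℂ (Finset (Fin d) × Finset (Fin d)) →ₗ[ℂ]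
    EuclideanSpace ℂ (Finset (Fin d) × Finset (Fin d)) where
  toFun c := WithLp.toLp 2 fun p => ∑ A, eigSign (p.1 ∆ p.2) A p.1 * c (A, A ∆ (p.1 ∆ p.2))
  map_add' c c' := by
    ext p
    simp [mul_add, Finset.sum_add_distrib]
  map_smul' r c := by
    ext p
    simp [Finset.mul_sum, mul_left_comm]

theorem eigBasisMap_apply (c : EuclideanSpace ℂ (Finset (Fin d) × Finset (Fin d)))
    (S T : Finset (Fin d)) : eigBasisMap d c (S, T) =
      ∑ A, eigSign (S ∆ T) A S * c (A, A ∆ (S ∆ T)) := rfl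

theorem eigBasisMap_injective : Function.Injective (eigBasisMap d) := by
  rw [← LinearMap.ker_eq_bot, LinearMap.ker_eq_bot']
  intro c hc
  ext ⟨A, B⟩
  have h : ∀ S, ∑ A', eigSign (A ∆ B) A' S * c (A', A' ∆ (A ∆ B)) = 0 := fun S => by
    have := congrArg (fun w : EuclideanSpace ℂ (Finset (Fin d) × Finset (Fin d)) =>
      w (S, S ∆ (A ∆ B))) hc
    simp only [eigBasisMap_apply, symmDiff_symmDiff_cancel_left] at this
    exact this
  have h2 : ∑ S, eigSign (A ∆ B) A S *
      ∑ A', eigSign (A ∆ B) A' S * c (A', A' ∆ (A ∆ B)) = 2 ^ d * c (A, B) := by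
    simp only [Finset.mul_sum, ← mul_assoc]
    rw [Finset.sum_comm]
    simp only [← Finset.sum_mul, sum_eigSign_mul_eigSign, ite_mul, zero_mul]
    simp
  simp only [h, mul_zero, Finset.sum_const_zero] at h2
  simpa using h2.symm

theorem sum_occSign (A B : Finset (Fin d)) :
    ∑ k ∈ A ∆ B, occSign A k = (A.card : ℂ) - B.card := by
  have hdisj : Disjoint (A \ B) (B \ A) := disjoint_sdiff_sdiff
  have h1 : ∑ k ∈ A \ B, occSign A k = ((A \ B).card : ℂ) := by
    rw [Finset.sum_congr rfl fun k hk => occSign_of_mem (Finset.mem_sdiff.1 hk).1]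
    simp
  have h2 : ∑ k ∈ B \ A, occSign A k = -((B \ A).card : ℂ) := by
    rw [Finset.sum_congr rfl fun k hk => occSign_of_notMem (Finset.mem_sdiff.1 hk).2]
    simp
  have h3 : ((A \ B).card : ℂ) + (A ∩ B).card = A.card := by
    exact_mod_cast Finset.card_sdiff_add_card_inter A B
  have h4 : ((B \ A).card : ℂ) + (A ∩ B).card = B.card := by
    rw [Finset.inter_comm]
    exact_mod_cast Finset.card_sdiff_add_card_inter B A
  have hsd : A ∆ B = A \ B ∪ B \ A := rfl
  rw [hsd, Finset.sum_union hdisj, h1, h2]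
  linear_combination h3 - h4

/-- The eigenvalue of `Λ` with label `(A, B)` is `2 (#A - #B)`. -/
theorem lambdaOp_eigBasisMap (c : EuclideanSpace ℂ (Finset (Fin d) × Finset (Fin d))) :
    lambdaOp d (eigBasisMap d c) =
      eigBasisMap d (WithLp.toLp 2 fun q => 2 * ((q.1.card : ℂ) - q.2.card) * c q) := by
  ext ⟨S, T⟩
  have hU : ∀ k, (S ∆ {k}) ∆ (T ∆ {k}) = S ∆ T := fun k => by
    rw [symmDiff_symmDiff_symmDiff_comm, symmDiff_self, symmDiff_bot]
  have hs : ∀ k A, eigSign (S ∆ T) A (S ∆ {k}) =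
      eigSign (S ∆ T) A S * (jwSign (S ∆ T) k * occSign A k) := fun k A => by
    rw [eigSign_symmDiff]
    simp [eigSign]
  simp only [lambdaOp_apply, eigBasisMap_apply, hU, hs, Finset.mul_sum]
  rw [Finset.sum_comm]
  refine Finset.sum_congr rfl fun A _ => ?_
  have h := sum_occSign A (A ∆ (S ∆ T))
  rw [symmDiff_symmDiff_cancel_left] at h
  rw [← h, Finset.mul_sum, Finset.sum_mul, Finset.mul_sum]
  refine Finset.sum_congr rfl fun k _ => ?_
  linear_combination 2 * eigSign (S ∆ T) A S * occSign A k * c (A, A ∆ (S ∆ T)) *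
    jwSign_mul_self (S ∆ T) k

/-- The vectors whose coordinates vanish outside `P`. -/
def supportedOn {κ : Type*} (P : κ → Prop) : Submodule ℂ (EuclideanSpace ℂ κ) where
  carrier := {w | ∀ p, ¬ P p → w p = 0}
  add_mem' := by
    intro a b ha hb p hp
    simp [ha p hp, hb p hp]
  zero_mem' := by
    intro p _
    simp
  smul_mem' := by
    intro c a ha p hp
    simp [ha p hp]

theorem mem_supportedOn {κ : Type*} {P : κ → Prop} {w : EuclideanSpace ℂ κ} :
    w ∈ supportedOn P ↔ ∀ p, ¬ P p → w p = 0 := Iff.rfl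

theorem finrank_supportedOn {κ : Type*} [Fintype κ] (P : κ → Prop) [DecidablePred P] :
    Module.finrank ℂ (supportedOn P) = (Finset.univ.filter P).card := by
  rw [← Fintype.card_subtype, ← Module.finrank_fintype_fun_eq_card (R := ℂ)]
  refine LinearEquiv.finrank_eq
    { toFun := fun w p => (w : EuclideanSpace ℂ κ) p
      map_add' := fun _ _ => rfl
      map_smul' := fun _ _ => rfl
      invFun := fun c => ⟨WithLp.toLp 2 fun p => if h : P p then c ⟨p, h⟩ else 0,
        fun p hp => by simp [hp]⟩
      left_inv := fun w => ?_
      right_inv := fun c => ?_ }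
  · ext p
    by_cases h : P p
    · simp [h]
    · simpa [h] using (w.2 p h).symm
  · ext p
    simp [p.2]

theorem ker_lambdaOp : LinearMap.ker (lambdaOp d) =
    (supportedOn fun q : Finset (Fin d) × Finset (Fin d) => q.1.card = q.2.card).map
      (eigBasisMap d) := by
  have hbij := LinearMap.injective_iff_surjective.1 (eigBasisMap_injective (d := d))
  ext w
  obtain ⟨c, rfl⟩ := hbij w
  rw [LinearMap.mem_ker, lambdaOp_eigBasisMap, map_eq_zero_iff _ eigBasisMap_injective,
    Submodule.mem_map]
  have h : (∃ y ∈ supportedOn fun q : Finset (Fin d) × Finset (Fin d) => q.1.card = q.2.card,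
      eigBasisMap d y = eigBasisMap d c) ↔
      c ∈ supportedOn fun q : Finset (Fin d) × Finset (Fin d) => q.1.card = q.2.card :=
    ⟨fun ⟨y, hy, hyc⟩ => eigBasisMap_injective hyc ▸ hy, fun h => ⟨c, h, rfl⟩⟩
  rw [h, mem_supportedOn]
  constructor
  · intro h0 q hq
    have := congrArg (fun w : EuclideanSpace ℂ (Finset (Fin d) × Finset (Fin d)) => w q) h0
    have hne : (q.1.card : ℂ) - q.2.card ≠ 0 := sub_ne_zero.2 (by exact_mod_cast hq)
    simpa [hne] using this
  · intro h0
    ext q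
    by_cases hq : q.1.card = q.2.card
    · simp [hq]
    · simp [h0 q hq]

theorem card_filter_card_eq (d : ℕ) : (Finset.univ.filter
    fun q : Finset (Fin d) × Finset (Fin d) => q.1.card = q.2.card).card = (2 * d).choose d := by
  have h : ∀ A : Finset (Fin d), (∑ B : Finset (Fin d), if A.card = B.card then 1 else 0) =
      d.choose A.card := by
    intro A
    rw [← Finset.card_filter]
    have : (Finset.univ.filter fun B : Finset (Fin d) => A.card = B.card) =
        Finset.powersetCard A.card Finset.univ := by
      ext B
      simp [Finset.mem_powersetCard, eq_comm]
    rw [this, Finset.card_powersetCard, Finset.card_univ, Fintype.card_fin]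
  rw [Finset.card_filter, Fintype.sum_prod_type, Finset.sum_congr rfl fun A _ => h A,
    ← Finset.powerset_univ, Finset.sum_powerset_apply_card fun m => d.choose m, Finset.card_univ,
    Fintype.card_fin, ← Nat.sum_range_choose_sq]
  simp [sq]

theorem finrank_ker_lambdaOp : Module.finrank ℂ (LinearMap.ker (lambdaOp d)) =
    (2 * d).choose d := by
  rw [ker_lambdaOp, (Submodule.equivMapOfInjective _ eigBasisMap_injective _).symm.finrank_eq,
    finrank_supportedOn, card_filter_card_eq]

/-! ### The kernel of `Λ` -/

theorem prod_jwSign_self (U : Finset (Fin d)) : ∏ k ∈ U, jwSign U k = (-1) ^ U.card.choose 2 := by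
  induction U using Finset.induction_on_max with
  | empty => simp
  | insert m U hm ih =>
    have hmU : m ∉ U := fun h => lt_irrefl _ (hm m h)
    have h1 : ∀ k ∈ U, jwSign (insert m U) k = jwSign U k := fun k hk => by
      rw [jwSign, Finset.prod_insert hmU, if_neg (hm k hk).not_gt, one_mul, jwSign]
    have h2 : jwSign (insert m U) m = (-1) ^ U.card := by
      rw [jwSign, Finset.prod_insert hmU, if_neg (lt_irrefl m), one_mul,
        Finset.prod_congr rfl fun j hj => if_pos (hm j hj), Finset.prod_const]
    rw [Finset.prod_insert hmU, h2, Finset.prod_congr rfl h1, ih, Finset.card_insert_of_notMem hmU,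
      Nat.choose_succ_succ, Nat.choose_one_right, pow_add]

/-- The exchange of the two copies fixes the eigenvectors of `Λ` with eigenvalue zero. -/
theorem eigSign_self {A B : Finset (Fin d)} (h : A.card = B.card) :
    eigSign (A ∆ B) A (A ∆ B) = 1 ∧ Even (A ∆ B).card := by
  have hdisj : Disjoint (A \ B) (B \ A) := disjoint_sdiff_sdiff
  have hsd : A ∆ B = A \ B ∪ B \ A := rfl
  have hcard : (A \ B).card = (B \ A).card := Finset.card_sdiff_comm h
  have hU : (A ∆ B).card = 2 * (B \ A).card := by
    rw [hsd, Finset.card_union_of_disjoint hdisj, hcard, two_mul]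
  have hocc : ∏ k ∈ A ∆ B, occSign A k = (-1) ^ (B \ A).card := by
    rw [hsd, Finset.prod_union hdisj,
      Finset.prod_congr rfl fun k hk => occSign_of_mem (Finset.mem_sdiff.1 hk).1,
      Finset.prod_congr (s₁ := B \ A) rfl fun k hk => occSign_of_notMem (Finset.mem_sdiff.1 hk).2]
    simp
  refine ⟨?_, hU ▸ even_two_mul _⟩
  rw [eigSign, Finset.prod_mul_distrib, prod_jwSign_self, hocc, hU, ← pow_add]
  refine Even.neg_one_pow ?_
  generalize (B \ A).card = q
  -- `(2q choose 2) + q = 2 q ^ 2`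
  have : (2 * q).choose 2 + q = 2 * (q * q) := by
    induction q with
    | zero => rfl
    | succ q ih =>
      have h1 : (2 * (q + 1)).choose 2 = (2 * q).choose 2 + 2 * q + (2 * q + 1) := by
        rw [show 2 * (q + 1) = 2 * q + 1 + 1 by ring, Nat.choose_succ_succ' _ 1,
          Nat.choose_succ_succ' _ 1, Nat.choose_one_right, Nat.choose_one_right]
        ring
      rw [h1]
      linarith
  rw [this]
  exact even_two_mul _

theorem ker_lambdaOp_le_invariantUnder_swap :
    LinearMap.ker (lambdaOp d) ≤ invariantUnder Prod.swap 1 := by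
  rw [ker_lambdaOp]
  rintro _ ⟨c, hc, rfl⟩
  rw [mem_invariantUnder_swap]
  intro S T
  rw [eigBasisMap_apply, eigBasisMap_apply, symmDiff_comm T S]
  refine Finset.sum_congr rfl fun A _ => ?_
  by_cases h : A.card = (A ∆ (S ∆ T)).card
  · have h1 := (eigSign_self h).1
    rw [symmDiff_symmDiff_cancel_left] at h1
    have hT : T = S ∆ (S ∆ T) := (symmDiff_symmDiff_cancel_left S T).symm
    rw [show eigSign (S ∆ T) A T = eigSign (S ∆ T) A S by
      conv_lhs => rw [hT, symmDiff_symmDiff_cancel_left, eigSign_symmDiff, h1, mul_one]]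
  · rw [hc (A, A ∆ (S ∆ T)) h, mul_zero, mul_zero]

theorem card_symmDiff_mod_two (S T : Finset (Fin d)) :
    (S ∆ T).card % 2 = (S.card + T.card) % 2 := by
  have hdisj : Disjoint (S \ T) (T \ S) := disjoint_sdiff_sdiff
  have hsd : S ∆ T = S \ T ∪ T \ S := rfl
  have h1 := Finset.card_sdiff_add_card_inter S T
  have h2 := Finset.card_sdiff_add_card_inter T S
  rw [Finset.inter_comm] at h2
  rw [hsd, Finset.card_union_of_disjoint hdisj]
  omega

/-- A vector in the kernel of `Λ` has no components of different parities in the two copies. -/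
theorem apply_eq_zero_of_mem_ker_lambdaOp
    {w : EuclideanSpace ℂ (Finset (Fin d) × Finset (Fin d))}
    (hw : w ∈ LinearMap.ker (lambdaOp d)) {S T : Finset (Fin d)} (h : S.card % 2 ≠ T.card % 2) :
    w (S, T) = 0 := by
  rw [ker_lambdaOp] at hw
  obtain ⟨c, hc, rfl⟩ := hw
  rw [eigBasisMap_apply]
  refine Finset.sum_eq_zero fun A _ => ?_
  rw [hc, mul_zero]
  intro hA
  have h1 := (eigSign_self hA).2
  rw [symmDiff_symmDiff_cancel_left, Nat.even_iff, card_symmDiff_mod_two] at h1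
  omega

end Fock

/-! ### The parity sectors of the Fock space -/

section Parity

variable {d : ℕ}

theorem mem_fockSector {r : Fin 2} {u : EuclideanSpace ℂ (Finset (Fin d))} :
    u ∈ fockSector d r ↔ ∀ S, S.card % 2 ≠ (r : ℕ) → u S = 0 := Iff.rfl

theorem mem_tensorSq_fockSector {r : Fin 2}
    {w : EuclideanSpace ℂ (Finset (Fin d) × Finset (Fin d))} :
    w ∈ tensorSq (fockSector d r) ↔
      ∀ S T : Finset (Fin d), ¬ (S.card % 2 = r ∧ T.card % 2 = r) → w (S, T) = 0 := by
  simp only [mem_tensorSq, mem_fockSector]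
  constructor
  · rintro ⟨h1, h2⟩ S T h
    by_cases hS : S.card % 2 = r
    · exact h2 S T fun hT => h ⟨hS, hT⟩
    · exact h1 T S hS
  · intro h
    exact ⟨fun T S hS => h S T fun h' => hS h'.1, fun S T hT => h S T fun h' => hT h'.2⟩

theorem card_symmDiff_singleton_mod_two (S : Finset (Fin d)) (k : Fin d) :
    (S ∆ {k}).card % 2 = 1 - S.card % 2 := by
  rw [card_symmDiff_mod_two, Finset.card_singleton]
  omega

theorem starProjection_tensorSq_fockSector_apply (r : Fin 2)
    (w : EuclideanSpace ℂ (Finset (Fin d) × Finset (Fin d))) (S T : Finset (Fin d)) :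
    (tensorSq (fockSector d r)).starProjection w (S, T) =
      if S.card % 2 = r ∧ T.card % 2 = r then w (S, T) else 0 := by
  let Q : EuclideanSpace ℂ (Finset (Fin d) × Finset (Fin d)) →ₗ[ℂ]
      EuclideanSpace ℂ (Finset (Fin d) × Finset (Fin d)) :=
    { toFun := fun w => WithLp.toLp 2 fun p =>
        if p.1.card % 2 = r ∧ p.2.card % 2 = r then w p else 0
      map_add' := fun v w => by
        ext p
        by_cases h : p.1.card % 2 = r ∧ p.2.card % 2 = r <;> simp [h]
      map_smul' := fun c w => by
        ext p
        by_cases h : p.1.card % 2 = r ∧ p.2.card % 2 = r <;> simp [h] }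
  have hQ : ∀ w p, LinearMap.toContinuousLinearMap Q w p =
      if p.1.card % 2 = r ∧ p.2.card % 2 = r then w p else 0 := fun _ _ => rfl
  have : LinearMap.toContinuousLinearMap Q = (tensorSq (fockSector d r)).starProjection := by
    refine eq_starProjection_of_symmetric (fun v w => ?_) (fun w => ?_) fun w hw => ?_
    · simp only [PiLp.inner_apply, hQ]
      refine Finset.sum_congr rfl fun p _ => ?_
      split_ifs <;> simp
    · exact mem_tensorSq_fockSector.2 fun S T h => by rw [hQ]; exact if_neg h
    · ext ⟨S, T⟩
      rw [hQ]
      split_ifs with h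
      · rfl
      · exact (mem_tensorSq_fockSector.1 hw S T h).symm
  rw [← this, hQ]

/-- `Λ` maps the sector of parity `(1 - r, 1 - r)` to the sector of parity `(r, r)`, so its kernel
is stable under the projections on these sectors. -/
theorem starProjection_tensorSq_fockSector_mem_ker (r : Fin 2)
    {w : EuclideanSpace ℂ (Finset (Fin d) × Finset (Fin d))}
    (hw : w ∈ LinearMap.ker (lambdaOp d)) :
    (tensorSq (fockSector d r)).starProjection w ∈ LinearMap.ker (lambdaOp d) := by
  rw [LinearMap.mem_ker]
  ext ⟨S, T⟩
  have h0 : lambdaOp d w (S, T) = 0 := by rw [LinearMap.mem_ker.1 hw]; rfl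
  rw [lambdaOp_apply] at h0 ⊢
  simp only [starProjection_tensorSq_fockSector_apply, card_symmDiff_singleton_mod_two]
  by_cases h : 1 - S.card % 2 = r ∧ 1 - T.card % 2 = r
  · simp only [h, and_self, if_true]
    exact h0
  · simp [h]

/-- The simultaneous change of the occupation of one mode in both copies. -/
def flipOp (k : Fin d) : EuclideanSpace ℂ (Finset (Fin d) × Finset (Fin d)) →L[ℂ]
    EuclideanSpace ℂ (Finset (Fin d) × Finset (Fin d)) :=
  permOp fun p => (p.1 ∆ {k}, p.2 ∆ {k})

theorem flipOp_apply (k : Fin d) (w : EuclideanSpace ℂ (Finset (Fin d) × Finset (Fin d)))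
    (S T : Finset (Fin d)) : flipOp k w (S, T) = w (S ∆ {k}, T ∆ {k}) := rfl

theorem flipOp_flipOp (k : Fin d) (w : EuclideanSpace ℂ (Finset (Fin d) × Finset (Fin d))) :
    flipOp k (flipOp k w) = w := by
  ext ⟨S, T⟩
  rw [flipOp_apply, flipOp_apply, symmDiff_symmDiff_cancel_right, symmDiff_symmDiff_cancel_right]

theorem lambdaOp_flipOp (k : Fin d) (w : EuclideanSpace ℂ (Finset (Fin d) × Finset (Fin d))) :
    lambdaOp d (flipOp k w) = flipOp k (lambdaOp d w) := by
  ext ⟨S, T⟩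
  have hU : (S ∆ {k}) ∆ (T ∆ {k}) = S ∆ T := by
    rw [symmDiff_symmDiff_symmDiff_comm, symmDiff_self, symmDiff_bot]
  rw [flipOp_apply, lambdaOp_apply, lambdaOp_apply, hU]
  refine Finset.sum_congr rfl fun j _ => ?_
  rw [flipOp_apply, symmDiff_right_comm S, symmDiff_right_comm T]

variable (d) in
/-- The part of the kernel of `Λ` in the tensor square of the sector of parity `r`. -/
def kerSector (r : Fin 2) : Submodule ℂ (EuclideanSpace ℂ (Finset (Fin d) × Finset (Fin d))) :=
  LinearMap.ker (lambdaOp d) ⊓ tensorSq (fockSector d r)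

theorem finrank_kerSector_le (hd : 1 ≤ d) {r s : Fin 2} (h : r ≠ s) :
    Module.finrank ℂ (kerSector d r) ≤ Module.finrank ℂ (kerSector d s) := by
  let k : Fin d := ⟨0, hd⟩
  have hinj : Function.Injective (flipOp k) := fun v w hvw => by
    rw [← flipOp_flipOp k v, hvw, flipOp_flipOp]
  have hle : (kerSector d r).map (flipOp k).toLinearMap ≤ kerSector d s := by
    rintro _ ⟨w, ⟨hw1, hw2⟩, rfl⟩
    refine ⟨?_, mem_tensorSq_fockSector.2 fun S T hST => ?_⟩
    · change lambdaOp d (flipOp k w) = 0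
      rw [lambdaOp_flipOp, LinearMap.mem_ker.1 hw1, map_zero]
    · refine mem_tensorSq_fockSector.1 hw2 _ _ fun h' => hST ?_
      rw [card_symmDiff_singleton_mod_two, card_symmDiff_singleton_mod_two] at h'
      dsimp only at h'
      have : (r : ℕ) ≠ s := fun h' => h (Fin.ext h')
      omega
  calc Module.finrank ℂ (kerSector d r)
      = Module.finrank ℂ ((kerSector d r).map (flipOp k).toLinearMap) :=
        (Submodule.equivMapOfInjective (flipOp k).toLinearMap hinj _).finrank_eq
    _ ≤ _ := Submodule.finrank_mono hle

/-- The kernel of `Λ` is divided equally between the two sectors. -/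
theorem two_mul_finrank_kerSector (hd : 1 ≤ d) (r : Fin 2) :
    2 * Module.finrank ℂ (kerSector d r) = (2 * d).choose d := by
  have h01 : Module.finrank ℂ (kerSector d 0) = Module.finrank ℂ (kerSector d 1) :=
    le_antisymm (finrank_kerSector_le hd (by decide)) (finrank_kerSector_le hd (by decide))
  have hinf : kerSector d 0 ⊓ kerSector d 1 = ⊥ := by
    rw [eq_bot_iff]
    rintro w ⟨⟨_, h0⟩, ⟨_, h1⟩⟩
    rw [Submodule.mem_bot]
    ext ⟨S, T⟩
    by_cases hS : S.card % 2 = (0 : Fin 2)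
    · refine mem_tensorSq_fockSector.1 h1 S T fun h => ?_
      exact absurd (hS.symm.trans h.1) (by decide)
    · exact mem_tensorSq_fockSector.1 h0 S T fun h => hS h.1
  have hsup : kerSector d 0 ⊔ kerSector d 1 = LinearMap.ker (lambdaOp d) := by
    refine le_antisymm (sup_le inf_le_left inf_le_left) fun w hw => ?_
    have hsum : w = (tensorSq (fockSector d 0)).starProjection w +
        (tensorSq (fockSector d 1)).starProjection w := by
      ext ⟨S, T⟩
      rw [PiLp.add_apply, starProjection_tensorSq_fockSector_apply,
        starProjection_tensorSq_fockSector_apply]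
      by_cases h : S.card % 2 = T.card % 2
      · have : T.card % 2 = 0 ∨ T.card % 2 = 1 := Nat.mod_two_eq_zero_or_one _
        rcases this with h' | h' <;> simp [h, h']
      · rw [apply_eq_zero_of_mem_ker_lambdaOp hw h]
        simp
    rw [hsum]
    exact Submodule.add_mem_sup
      ⟨starProjection_tensorSq_fockSector_mem_ker 0 hw, Submodule.starProjection_apply_mem _ _⟩
      ⟨starProjection_tensorSq_fockSector_mem_ker 1 hw, Submodule.starProjection_apply_mem _ _⟩
  have h := Submodule.finrank_sup_add_finrank_inf_eq (kerSector d 0) (kerSector d 1)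
  rw [hinf, hsup, finrank_bot, finrank_ker_lambdaOp, add_zero] at h
  fin_cases r
  · change 2 * Module.finrank ℂ (kerSector d 0) = _
    omega
  · change 2 * Module.finrank ℂ (kerSector d 1) = _
    omega

theorem card_filter_card_mod_two (hd : 1 ≤ d) (r : Fin 2) :
    (Finset.univ.filter fun S : Finset (Fin d) => S.card % 2 = r).card = 2 ^ (d - 1) := by
  let k : Fin d := ⟨0, hd⟩
  have hflip : (Finset.univ.filter fun S : Finset (Fin d) => S.card % 2 = r).card =
      (Finset.univ.filter fun S : Finset (Fin d) => ¬ S.card % 2 = r).card := by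
    refine Finset.card_equiv (symmDiff_left_involutive ({k} : Finset (Fin d))).toPerm fun S => ?_
    have h := card_symmDiff_singleton_mod_two S k
    simp only [Finset.mem_filter, Finset.mem_univ, true_and, Function.Involutive.coe_toPerm, h]
    omega
  have htot := Finset.card_filter_add_card_filter_not (s := Finset.univ)
    fun S : Finset (Fin d) => S.card % 2 = r
  rw [← hflip, Finset.card_univ, Fintype.card_finset, Fintype.card_fin] at htot
  obtain ⟨e, rfl⟩ : ∃ e, d = e + 1 := ⟨d - 1, by omega⟩
  rw [pow_succ] at htot
  rw [Nat.add_sub_cancel]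
  omega

theorem finrank_fockSector (hd : 1 ≤ d) (r : Fin 2) :
    Module.finrank ℂ (fockSector d r) = 2 ^ (d - 1) := by
  have : fockSector d r = supportedOn fun S : Finset (Fin d) => S.card % 2 = r := rfl
  rw [this, finrank_supportedOn, card_filter_card_mod_two hd]

/-! ### Fermionic Gaussian states -/

theorem gaussA_eq (r : Fin 2) :
    gaussA d r = (symSq (fockSector d r)).starProjection - (kerSector d r).starProjection := by
  have h1 : symSq (⊤ : Submodule ℂ (EuclideanSpace ℂ (Finset (Fin d)))) =
      invariantUnder Prod.swap 1 := by
    rw [symSq, tensorSq_top, top_inf_eq]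
  have h2 : symSq (⊤ : Submodule ℂ (EuclideanSpace ℂ (Finset (Fin d)))) ⊓
      tensorSq (fockSector d r) = symSq (fockSector d r) := by
    rw [h1, inf_comm]
    rfl
  rw [gaussA, compress_sub]
  refine congrArg₂ (· - ·) ?_ ?_
  · rw [compress, starProjection_mul_mul_of_mapsTo]
    · simp only [h2]
    · rw [h1]
      exact fun w => starProjection_tensorSq_mem_invariantUnder_swap
  · exact starProjection_mul_mul_of_mapsTo fun w =>
      starProjection_tensorSq_fockSector_mem_ker r

theorem tableRow_gauss (d : ℕ) (hd : 1 ≤ d) (r : Fin 2) :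
    TableRow (fockSector d r) (gaussA d r) (2 ^ (d - 1))
      (((2 * d).choose d : ℝ) / (((2 : ℝ) ^ (d - 1) + 1) * (2 : ℝ) ^ (d - 1))) := by
  refine tableRow_of_fixed (F := kerSector d r) (gaussA_eq r)
    (fun v w => Submodule.inner_starProjection_left_eq_right _ v w) (fun w => ?_)
    (fun w => Submodule.starProjection_eq_self_iff.symm) (finrank_fockSector hd r) (by positivity)
    ?_
  · have h := Submodule.starProjection_apply_mem (kerSector d r) w
    exact ⟨h.2, ker_lambdaOp_le_invariantUnder_swap h.1⟩
  · rw [← two_mul_finrank_kerSector hd r]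
    push_cast
    field_simp

end Parity

end QCorr

end

theorem mainTheorem4 :
    (∀ d L : ℕ, 1 ≤ d → 1 ≤ L →
      QCorr.TableRow ⊤ (QCorr.sepA d L) (d ^ L)
        ((2 : ℝ) ^ (1 - (L : ℤ)) * (((d : ℝ) + 1) ^ L / ((d : ℝ) ^ L + 1)))) ∧
    (∀ d L : ℕ, 1 ≤ d → 1 ≤ L →
      QCorr.TableRow (QCorr.bosonSpace d L) (QCorr.bosonA d L) ((d + L - 1).choose L)
        (2 * ((d + 2 * L - 1).choose (2 * L) : ℝ) /
          (((d + L - 1).choose L : ℝ) * (((d + L - 1).choose L : ℝ) + 1)))) ∧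
    (∀ d L : ℕ, 1 ≤ L → L ≤ d →
      QCorr.TableRow (QCorr.fermionSpace d L) (QCorr.slaterA d L) (d.choose L)
        (2 * (d.choose L : ℝ) / ((d.choose L : ℝ) + 1) *
          (((d : ℝ) + 1) / (((L : ℝ) + 1) * ((d : ℝ) + 1 - (L : ℝ)))))) ∧
    (∀ d : ℕ, 1 ≤ d → ∀ r : Fin 2,
      QCorr.TableRow (QCorr.fockSector d r) (QCorr.gaussA d r) (2 ^ (d - 1))
        (((2 * d).choose d : ℝ) / (((2 : ℝ) ^ (d - 1) + 1) * (2 : ℝ) ^ (d - 1)))) :=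
  ⟨fun d L hd _ => QCorr.tableRow_separable d L hd, fun d L hd _ => QCorr.tableRow_boson d L hd,
    fun d L _ hL => QCorr.tableRow_slater d L hL, fun d hd r => QCorr.tableRow_gauss d hd r⟩
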